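/- **Setting.** Let $p,q\ge 0$ be integers, let $K\subset\mathbb R^d$ be compact, $\theta_0\in K$, and let $(Z_t)_{t\in\mathbb Z}$ be i.i.d. real random variables on a probability space with $\mathbb E Z_0=0$, $\mathbb E Z_0^2=1$; put $\mathcal F_t=\sigma(Z_k;\,k\le t)$. Let $\{g_\theta:\theta\in K\}$ be a family of functions $g_\theta:\mathbb R^p\times[0,\infty)^q\to[0,\infty)$ such that $x\mapsto g_\theta(x,s)$ is Borel measurable for all $\theta,s$. A solution of the model (with parameter $\theta_0$) is a process $((X_t,\sigma_t))_{t\in\mathbb Z}$ with $\sigma_t\ge 0$, $\sigma_t$ being $\mathcal F_{t-1}$-measurable, and almost surely, for all $t\in\mathbb Z$, $$X_t=\sigma_tZ_t,\qquad \sigma_t^2=g_{\theta_0}(\mathbf X_{t-1},\boldsymbol\sigma_{t-1}^2),$$ where $\mathbf X_t=(X_t,\dots,X_{t-p+1})^T$ and $\boldsymbol\sigma_t^2=(\sigma_t^2,\dots,\sigma_{t-q+1}^2)^T$. Let $\mathbb C(K,[0,\infty)^q)$ be the space of continuous functions $K\to[0,\infty)^q$ with the metric $\|u-v\|_K$, where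 $\|v\|_K=\sup_{\theta\in K}|v(\theta)|$ and $|\cdot|$ is the Euclidean norm, and with its Borel $\sigma$-field. For a self-map $\phi$ of this space put $\Lambda(\phi)=\sup_{u\ne v}\|\phi(u)-\phi(v)\|_K/\|u-v\|_K\in[0,\infty]$. Define the random maps $\Phi_t$ ($t\in\mathbb Z$) by $$[\Phi_t(\mathbf s)](\theta)=\bigl(g_\theta(\mathbf X_t,\mathbf s(\theta)),s_1(\theta),\dots,s_{q-1}(\theta)\bigr)^T,\qquad \theta\in K$$ (for $q=0$ all vectors of length $q$ are empty), and $\Phi_t^{(r)}=\Phi_t\circ\Phi_{t-1}\circ\cdots\circ\Phi_{t-r+1}$ for $r\ge1$. For $\varsigma\in[0,\infty)^q$ let $\hat{\mathbf h}_0\equiv\varsigma$ (a constant function on $K$) and $\hat{\mathbf h}_t=\Phi_{t-1}(\hat{\mathbf h}_{t-1})$ for $t\ge1$. A sequence is called stationary ergodic if its law on path space is invariant under the time shift and the shift is ergodic for this law. **Proposition 3.12.** Assume that the model with parameter $\theta_0$ has a unique stationary ergodic solution $((X_t,\sigma_t))$ and that $(\theta,s)\mapsto g_\theta(x,s)$ is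 continuous on $K\times[0,\infty)^q$ for every $x\in\mathbb R^p$. Then $(\Phi_t)_{t\in\mathbb Z}$ is a stationary ergodic sequence of random maps $\mathbb C(K,[0,\infty)^q)\to\mathbb C(K,[0,\infty)^q)$ (with respect to the $\sigma$-field generated by the evaluations $\phi\mapsto\phi(\mathbf s)$). Let $\varsigma\in[0,\infty)^q$ and suppose moreover that 1. $\mathbb E[\log^+\|\Phi_0(\varsigma)\|_K]<\infty$; 2. $\mathbb E[\log^+\Lambda(\Phi_0)]<\infty$, and there is an integer $r\ge1$ such that $\mathbb E[\log\Lambda(\Phi_0^{(r)})]<0$ (the value $-\infty$ being allowed). Then the stochastic recurrence equation $\mathbf s_{t+1}=\Phi_t(\mathbf s_t)$, $t\in\mathbb Z$, has a stationary solution $(\mathbf h_t)_{t\in\mathbb Z}$, which is unique (up to almost sure equality) among all stationary solutions, and it is ergodic. For every $t\in\mathbb Z$, $\mathbf h_t$ is $\mathcal F_{t-1}$-measurable (after modification on a null set) and $\mathbf h_t(\theta_0)=\boldsymbol\sigma_t^2$ almost surely. Moreover, $\|\hat{\mathbf h}_t-\mathbf h_t\|_K\to0$ exponentially fast almost surely: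 there is a constant $\gamma>1$ with $\gamma^t\|\hat{\mathbf h}_t-\mathbf h_t\|_K\to0$ almost surely as $t\to\infty$. -/

import Mathlib

open MeasureTheory ProbabilityTheory Filter Topology TopologicalSpace
open scoped NNReal ENNReal

noncomputable section

namespace CondHet

/-! ### Stationary ergodic sequences, exponentially fast almost sure convergence -/

section Sequences

variable {Ω : Type*} [MeasurableSpace Ω]

/-- The time shift on the path space `E^ℤ`. -/
def shift {E : Type*} (v : ℤ → E) : ℤ → E := fun t => v (t + 1)

/-- The sequence `(v_t)_{t ∈ ℤ}` of random elements of `E` is (strictly) stationary: its law on the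
path space `E^ℤ` (with the product σ-field) is invariant under the time shift. -/
def IsStationary {E : Type*} [MeasurableSpace E] (P : Measure Ω) (v : ℤ → Ω → E) : Prop :=
  (∀ t, Measurable (v t)) ∧
    MeasurePreserving (shift (E := E)) (P.map fun ω t => v t ω) (P.map fun ω t => v t ω)

/-- The sequence `(v_t)_{t ∈ ℤ}` is stationary and ergodic: the time shift preserves its law on the
path space and is ergodic for it. -/
def IsStationaryErgodic {E : Type*} [MeasurableSpace E] (P : Measure Ω) (v : ℤ → Ω → E) : Prop :=
  (∀ t, Measurable (v t)) ∧ Ergodic (shift (E := E)) (P.map fun ω t => v t ω)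

/-- `v_t → 0` exponentially fast almost surely as `t → ∞`. -/
def TendstoZeroEAS {B : Type*} [NormedAddCommGroup B] (P : Measure Ω) (v : ℕ → Ω → B) : Prop :=
  ∃ γ : ℝ, 1 < γ ∧ ∀ᵐ ω ∂P, Tendsto (fun t : ℕ => γ ^ t * ‖v t ω‖) atTop (𝓝 0)

end Sequences

/-! ### Lipschitz coefficients, iterates, logarithmic moments -/

/-- `Λ(φ) = sup_{x ≠ y} d(φ x, φ y) / d(x, y)`, with values in `[0, ∞]`. -/
def lipCoeff {E : Type*} [MetricSpace E] (φ : E → E) : ℝ≥0∞ :=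
  ⨆ (x : E) (y : E) (_ : x ≠ y), edist (φ x) (φ y) / edist x y

/-- The iterates `φ_t^{(0)} = id`, `φ_t^{(r)} = φ_t ∘ φ_{t-1} ∘ ⋯ ∘ φ_{t-r+1}`. -/
def pastIterate {E : Type*} (φ : ℤ → E → E) (t : ℤ) : ℕ → E → E
  | 0 => id
  | r + 1 => pastIterate φ t r ∘ φ (t - r)

/-- Positive part of the logarithm, `log⁺ a`, for `a ∈ [0, ∞]`. -/
def logPos (a : ℝ≥0∞) : ℝ≥0∞ := (ENNReal.log a).toENNReal

/-- Negative part of the logarithm, `log⁻ a = (-log a)⁺`, for `a ∈ [0, ∞]`; `log⁻ 0 = ∞`. -/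
def logNeg (a : ℝ≥0∞) : ℝ≥0∞ := (-ENNReal.log a).toENNReal

/-- `E[log⁺ Y] < ∞`. -/
def FiniteLogPosMoment {Ω : Type*} [MeasurableSpace Ω] (P : Measure Ω) (Y : Ω → ℝ≥0∞) : Prop :=
  ∫⁻ ω, logPos (Y ω) ∂P < ∞

/-- `E[log Y] < 0`, where the expectation `E[log Y] = E[log⁺ Y] - E[log⁻ Y]` exists in `[-∞, ∞)`.
The strict inequality below forces `E[log⁺ Y] < ∞`; the value `-∞` is allowed. -/
def NegativeLogMean {Ω : Type*} [MeasurableSpace Ω] (P : Measure Ω) (Y : Ω → ℝ≥0∞) : Prop :=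
  ∫⁻ ω, logPos (Y ω) ∂P < ∫⁻ ω, logNeg (Y ω) ∂P

/-! ### The state spaces `[0, ∞)^q` and `C(K, [0, ∞)^q)` -/

/-- The orthant `[0, ∞)^q` with the Euclidean metric. -/
abbrev Orthant (q : ℕ) : Type := PiLp 2 (fun _ : Fin q => ℝ≥0)

/-- The space `C(K, [0, ∞)^q)` of continuous functions on a compact `K ⊂ ℝ^d`; its metric is the
supremum over `K` of the Euclidean distance. -/
abbrev VolFun {d : ℕ} (K : Compacts (EuclideanSpace ℝ (Fin d))) (q : ℕ) : Type := C(K, Orthant q)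

section VolFun

variable {d : ℕ} {K : Compacts (EuclideanSpace ℝ (Fin d))} {q : ℕ}

instance : MeasurableSpace (VolFun K q) := borel _

instance : BorelSpace (VolFun K q) := ⟨rfl⟩

/-- The inclusion of `C(K, [0, ∞)^q)` into the Banach space `C(K, ℝ^q)` with the norm
`‖v‖_K = sup_{θ ∈ K} |v(θ)|`. -/
def toVec (f : VolFun K q) : C(K, EuclideanSpace ℝ (Fin q)) where
  toFun θ := WithLp.toLp 2 fun i => ((f θ i : ℝ≥0) : ℝ)
  continuous_toFun := by fun_prop

theorem dist_eq_norm_toVec (f f' : VolFun K q) : dist f f' = ‖toVec f - toVec f'‖ := by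
  have key : ∀ θ : K, dist (f θ) (f' θ) = dist (toVec f θ) (toVec f' θ) := by
    intro θ
    rw [EuclideanSpace.dist_eq, PiLp.dist_eq_sum (by norm_num)]
    simp [toVec, NNReal.dist_eq, Real.dist_eq, Real.sqrt_eq_rpow]
  rw [← dist_eq_norm]
  apply le_antisymm
  · rw [ContinuousMap.dist_le dist_nonneg]
    intro θ
    rw [key]
    exact ContinuousMap.dist_apply_le_dist θ
  · rw [ContinuousMap.dist_le dist_nonneg]
    intro θ
    rw [← key]
    exact ContinuousMap.dist_apply_le_dist θ

end VolFun

/-! ### The model -/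

section Model

variable {Ω : Type*}

/-- `F_t = σ(Z_k ; k ≤ t)`. -/
@[reducible] def past (Z : ℤ → Ω → ℝ) (t : ℤ) : MeasurableSpace Ω :=
  ⨆ k : ℤ, ⨆ _ : k ≤ t, MeasurableSpace.comap (Z k) inferInstance

/-- The vector `(X_t, …, X_{t-p+1})`. -/
def obsVec (p : ℕ) (X : ℤ → Ω → ℝ) (t : ℤ) (ω : Ω) : Fin p → ℝ := fun i => X (t - (i : ℕ)) ω

/-- The vector `(σ_t², …, σ_{t-q+1}²)`. -/
def volVec (q : ℕ) (σ : ℤ → Ω → ℝ≥0) (t : ℤ) (ω : Ω) : Orthant q :=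
  WithLp.toLp 2 fun j => σ (t - (j : ℕ)) ω ^ 2

variable [MeasurableSpace Ω]

/-- `(Z_t)` is an i.i.d. sequence of random variables with mean zero and unit second moment. -/
structure IsInnovation (P : Measure Ω) (Z : ℤ → Ω → ℝ) : Prop where
  measurable : ∀ t, Measurable (Z t)
  indep : iIndepFun Z P
  ident : ∀ t, IdentDistrib (Z t) (Z 0) P P
  mean : ∫ ω, Z 0 ω ∂P = 0
  second_moment : ∫ ω, Z 0 ω ^ 2 ∂P = 1

/-- `((X_t, σ_t))` solves, for the volatility function `g`, the model equations
`X_t = σ_t Z_t`, `σ_t² = g(X_{t-1}, …, X_{t-p}; σ_{t-1}², …, σ_{t-q}²)`, almost surely for every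
`t ∈ ℤ`, where `σ_t ≥ 0` is `F_{t-1}`-measurable. -/
structure IsModelSolution (P : Measure Ω) (Z : ℤ → Ω → ℝ) {p q : ℕ}
    (g : (Fin p → ℝ) → Orthant q → ℝ≥0) (X : ℤ → Ω → ℝ) (σ : ℤ → Ω → ℝ≥0) : Prop where
  measurable_obs : ∀ t, Measurable (X t)
  adapted : ∀ t, Measurable[past Z (t - 1)] (σ t)
  obs_eq : ∀ t, ∀ᵐ ω ∂P, X t ω = σ t ω * Z t ω
  vol_eq : ∀ t, ∀ᵐ ω ∂P, σ t ω ^ 2 = g (obsVec p X (t - 1) ω) (volVec q σ (t - 1) ω)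

/-- `((X_t, σ_t))` is a stationary ergodic solution of the model, and any other such solution
agrees with it almost surely. -/
structure IsUniqueStationaryErgodicSolution (P : Measure Ω) (Z : ℤ → Ω → ℝ) {p q : ℕ}
    (g : (Fin p → ℝ) → Orthant q → ℝ≥0) (X : ℤ → Ω → ℝ) (σ : ℤ → Ω → ℝ≥0) : Prop where
  solution : IsModelSolution P Z g X σ
  stationary_ergodic : IsStationaryErgodic P fun t ω => (X t ω, σ t ω)
  unique : ∀ (X' : ℤ → Ω → ℝ) (σ' : ℤ → Ω → ℝ≥0), IsModelSolution P Z g X' σ' →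
    IsStationaryErgodic P (fun t ω => (X' t ω, σ' t ω)) →
      ∀ t, ∀ᵐ ω ∂P, X' t ω = X t ω ∧ σ' t ω = σ t ω

end Model

/-! ### The random maps `Φ_t`, the recursion for `ĥ_t` and the stochastic recurrence equation -/

section SRE

variable {d : ℕ} {K : Compacts (EuclideanSpace ℝ (Fin d))} {p q : ℕ}

/-- The vector `(a, s_1, …, s_{q-1})`. -/
def consShift (a : ℝ≥0) (s : Orthant q) : Orthant q :=
  WithLp.toLp 2 fun i : Fin q =>
    if (i : ℕ) = 0 then a else s ⟨(i : ℕ) - 1, (Nat.sub_le _ _).trans_lt i.isLt⟩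

theorem continuous_consShift {T : Type*} [TopologicalSpace T] {a : T → ℝ≥0} {s : T → Orthant q}
    (ha : Continuous a) (hs : Continuous s) : Continuous fun τ => consShift (a τ) (s τ) := by
  refine (PiLp.continuous_toLp 2 _).comp (continuous_pi fun i => ?_)
  by_cases hi : (i : ℕ) = 0
  · simpa [hi] using ha
  · simp only [hi, if_false]
    fun_prop

/-- For `x ∈ ℝ^p`, the map `s ↦ (θ ↦ (g_θ(x, s(θ)), s_1(θ), …, s_{q-1}(θ)))` of `C(K, [0, ∞)^q)`
into itself. -/
def volMap (g : K → (Fin p → ℝ) → Orthant q → ℝ≥0)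
    (hg : ∀ x, Continuous fun y : K × Orthant q => g y.1 x y.2)
    (x : Fin p → ℝ) (s : VolFun K q) : VolFun K q where
  toFun θ := consShift (g θ x (s θ)) (s θ)
  continuous_toFun := continuous_consShift
    ((hg x).comp (continuous_id.prodMk s.continuous)) s.continuous

/-- The random maps `Φ_t`: `[Φ_t(s)](θ) = (g_θ(X_t, …, X_{t-p+1}, s(θ)), s_1(θ), …, s_{q-1}(θ))`. -/
def Phi {Ω : Type*} (g : K → (Fin p → ℝ) → Orthant q → ℝ≥0)
    (hg : ∀ x, Continuous fun y : K × Orthant q => g y.1 x y.2)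
    (X : ℤ → Ω → ℝ) (t : ℤ) (ω : Ω) : VolFun K q → VolFun K q :=
  volMap g hg (obsVec p X t ω)

/-- The recursion `ĥ_0 = ς` (a constant function on `K`), `ĥ_{t+1} = Φ_t(ĥ_t)` for `t ∈ ℕ`. -/
def hHat {Ω : Type*} (g : K → (Fin p → ℝ) → Orthant q → ℝ≥0)
    (hg : ∀ x, Continuous fun y : K × Orthant q => g y.1 x y.2)
    (X : ℤ → Ω → ℝ) (ς : Orthant q) : ℕ → Ω → VolFun K q
  | 0, _ => ContinuousMap.const K ς
  | t + 1, ω => Phi g hg X (t : ℤ) ω (hHat g hg X ς t ω)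

/-- `(h_t)_{t ∈ ℤ}` is a solution of the stochastic recurrence equation `s_{t+1} = Φ_t(s_t)`. -/
def IsSRESolution {Ω E : Type*} [MeasurableSpace Ω] (P : Measure Ω)
    (Φ : ℤ → Ω → E → E) (h : ℤ → Ω → E) : Prop :=
  ∀ t, ∀ᵐ ω ∂P, h (t + 1) ω = Φ t ω (h t ω)

end SRE

end CondHet

end

/-! Everything is moved to the path space of `X`, where `Φ_t = ψ ∘ θ^t` for one map-valued function
`ψ` and the ergodic shift `θ`. The core is the almost sure exponential decay of the Lipschitz
coefficients of the iterates, both forward from time 0 and backward into the past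
(`exists_exponential_contraction`).

Kingman's theorem is not needed for this. By submultiplicativity, the `r`-th power of the
coefficient of a long window is at most the product of the coefficients of all its subwindows of
length `r`, times edge terms (`submul_le_expE`). Averaging over all `r` offsets leaves a Birkhoff
sum for the shift itself, so ergodicity of its `r`-th power plays no role. A negative mean makes
this sum decrease linearly, by a maximal inequality (`ae_bddAbove_birkhoffSum`), and the edge terms
grow sublinearly, by Borel–Cantelli (`ae_eventually_iterate_le`). Truncating `log⁻` reduces to
integrable functions.

Backward contraction and the moment condition at `ς` make the backward iterates from `ς` converge;
their limit is `h`, a factor of the stationary ergodic observations and a function of the past.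
Uniqueness and `h_t(θ₀) = σ_t²` have one cause: two stationary sequences driven by the same maps
differ at time `t` by at most a coefficient tending to 0 times a tight distance in the remote past
(`ae_eq_zero_of_contraction`). Forward contraction gives the rate for `ĥ_t`. -/

namespace CondHet

/-! ### A maximal ergodic inequality -/

section MaximalErgodic

variable {α : Type*}

/-- The running maxima `max(0, S_1, …, S_n)` of the Birkhoff sums of `f` along `T`. -/
def maxBirkhoff (T : α → α) (f : α → ℝ) : ℕ → α → ℝ
  | 0, _ => 0
  | n + 1, x => max 0 (f x + maxBirkhoff T f n (T x))

theorem maxBirkhoff_nonneg (T : α → α) (f : α → ℝ) (n : ℕ) (x : α) : 0 ≤ maxBirkhoff T f n x := by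
  cases n with
  | zero => exact le_rfl
  | succ n => exact le_max_left _ _

theorem maxBirkhoff_le_succ (T : α → α) (f : α → ℝ) (n : ℕ) :
    ∀ x, maxBirkhoff T f n x ≤ maxBirkhoff T f (n + 1) x := by
  induction n with
  | zero => exact fun x => le_max_left _ _
  | succ n ih => exact fun x => max_le_max le_rfl (by gcongr; exact ih _)

theorem monotone_maxBirkhoff (T : α → α) (f : α → ℝ) (x : α) :
    Monotone fun n => maxBirkhoff T f n x :=
  monotone_nat_of_le_succ fun n => maxBirkhoff_le_succ T f n x

theorem birkhoffSum_le_maxBirkhoff (T : α → α) (f : α → ℝ) (n : ℕ) :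
    ∀ x, birkhoffSum T f n x ≤ maxBirkhoff T f n x := by
  induction n with
  | zero => simp [maxBirkhoff]
  | succ n ih =>
    intro x
    rw [birkhoffSum_succ']
    exact le_max_of_le_right (by gcongr; exact ih _)

/-- The recursion changes the running maxima only by the finite amount `f x` and a positive part.
Hence the set where they are unbounded is exactly invariant, and ergodicity gives it measure zero or
full measure. -/
theorem bddAbove_maxBirkhoff_comp_iff (T : α → α) (f : α → ℝ) (x : α) :
    BddAbove (Set.range fun n => maxBirkhoff T f n (T x)) ↔
      BddAbove (Set.range fun n => maxBirkhoff T f n x) := by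
  constructor
  · rintro ⟨C, hC⟩
    refine ⟨max 0 (f x + C), ?_⟩
    rintro _ ⟨n, rfl⟩
    cases n with
    | zero => exact le_max_left _ _
    | succ n => exact max_le_max le_rfl (by gcongr; exact hC ⟨n, rfl⟩)
  · rintro ⟨C, hC⟩
    refine ⟨C - f x, ?_⟩
    rintro _ ⟨n, rfl⟩
    have h1 : maxBirkhoff T f (n + 1) x ≤ C := hC ⟨n + 1, rfl⟩
    have h2 : f x + maxBirkhoff T f n (T x) ≤ maxBirkhoff T f (n + 1) x := le_max_right _ _
    simp only
    linarith

variable [MeasurableSpace α] {μ : Measure α} {T : α → α} {f : α → ℝ}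

theorem measurable_maxBirkhoff (hT : Measurable T) (hf : Measurable f) (n : ℕ) :
    Measurable (maxBirkhoff T f n) := by
  induction n with
  | zero => exact measurable_const
  | succ n ih => exact measurable_const.max (hf.add (ih.comp hT))

theorem integrable_maxBirkhoff (hT : MeasurePreserving T μ μ) (hfi : Integrable f μ) (n : ℕ) :
    Integrable (maxBirkhoff T f n) μ := by
  induction n with
  | zero => exact integrable_zero _ _ _
  | succ n ih =>
    exact (integrable_zero _ _ _).sup (hfi.add (hT.integrable_comp_of_integrable ih))

/-- If an integrable function has a negative integral, its Birkhoff sums along an ergodic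
transformation are almost surely bounded above. -/
theorem ae_bddAbove_birkhoffSum (hT : Ergodic T μ) (hf : Measurable f) (hfi : Integrable f μ)
    (hneg : ∫ x, f x ∂μ < 0) :
    ∀ᵐ x ∂μ, BddAbove (Set.range fun n => birkhoffSum T f n x) := by
  have hM := measurable_maxBirkhoff hT.measurable hf
  set A : Set α := {x | ¬ BddAbove (Set.range fun n => maxBirkhoff T f n x)} with hA
  have hAm : MeasurableSet A := by
    have : A = ⋂ k : ℕ, ⋃ n : ℕ, {x | (k : ℝ) < maxBirkhoff T f n x} := by
      ext x
      simp only [hA, Set.mem_ofPred_eq, Set.mem_iInter, Set.mem_iUnion, not_bddAbove_iff,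
        Set.exists_range_iff]
      exact ⟨fun h k => h k, fun h c => by
        obtain ⟨k, hk⟩ := exists_nat_gt c
        obtain ⟨n, hn⟩ := h k
        exact ⟨n, hk.trans hn⟩⟩
    rw [this]
    exact .iInter fun k => .iUnion fun n => measurableSet_lt measurable_const (hM n)
  have hTA : T ⁻¹' A = A := by
    ext x
    exact not_congr (bddAbove_maxBirkhoff_comp_iff T f x)
  rcases hT.toPreErgodic.ae_mem_or_ae_notMem hAm hTA with h | h
  · exfalso
    -- With `M_n` the running maxima, the integrand is `M_{n+1} - M_n ∘ T`. It is dominated by `|f|`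
    -- and eventually equals `f` where `M_n ∘ T → ∞`. Its integral is that of `M_{n+1} - M_n`, hence
    -- nonnegative, which would force `∫ f ≥ 0`.
    have hlim : Tendsto (fun n => ∫ x, max (-maxBirkhoff T f n (T x)) (f x) ∂μ) atTop
        (𝓝 (∫ x, f x ∂μ)) := by
      refine tendsto_integral_of_dominated_convergence (fun x => |f x|) (fun n => ?_) hfi.abs
        (fun n => ?_) ?_
      · exact (((hM n).comp hT.measurable).neg.max hf).aestronglyMeasurable
      · refine Eventually.of_forall fun x => ?_
        rw [Real.norm_eq_abs, abs_le]
        exact ⟨le_max_of_le_right (neg_abs_le _), max_le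
          ((neg_nonpos.2 (maxBirkhoff_nonneg T f n _)).trans (abs_nonneg _)) (le_abs_self _)⟩
      · filter_upwards [h] with x hx
        rw [← hTA] at hx
        have hx' : ¬ BddAbove (Set.range fun n => maxBirkhoff T f n (T x)) := hx
        have ht := tendsto_atTop_atTop_of_monotone' (monotone_maxBirkhoff T f (T x)) hx'
        refine tendsto_const_nhds.congr' ?_
        filter_upwards [ht.eventually_ge_atTop (-f x)] with n hn
        exact (max_eq_right (by linarith)).symm
    refine hneg.not_ge (ge_of_tendsto' hlim fun n => ?_)
    have hMi := integrable_maxBirkhoff hT.toMeasurePreserving hfi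
    have e : ∀ x, max (-maxBirkhoff T f n (T x)) (f x)
        = maxBirkhoff T f (n + 1) x - maxBirkhoff T f n (T x) := by
      intro x
      rw [maxBirkhoff, ← max_sub_sub_right]
      simp
    simp_rw [e]
    have hMT : Integrable (fun x => maxBirkhoff T f n (T x)) μ :=
      hT.toMeasurePreserving.integrable_comp_of_integrable (hMi n)
    rw [integral_sub (hMi _) hMT]
    have : ∫ x, maxBirkhoff T f n (T x) ∂μ = ∫ x, maxBirkhoff T f n x ∂μ := by
      conv_rhs => rw [← hT.map_eq]
      exact (integral_map hT.measurable.aemeasurable (hM n).aestronglyMeasurable).symm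
    rw [this, sub_nonneg]
    exact integral_mono (hMi n) (hMi _) (maxBirkhoff_le_succ T f n)
  · filter_upwards [h] with x hx
    obtain ⟨C, hC⟩ := not_not.1 hx
    refine ⟨C, ?_⟩
    rintro _ ⟨n, rfl⟩
    exact (birkhoffSum_le_maxBirkhoff T f n x).trans (hC ⟨n, rfl⟩)

/-- An integrable nonnegative function grows sublinearly along the orbits of a measure preserving
transformation. -/
theorem ae_eventually_iterate_le [IsProbabilityMeasure μ] (hT : MeasurePreserving T μ μ)
    (hf : Measurable f) (hfi : Integrable f μ) (hf0 : 0 ≤ f) {ε : ℝ} (hε : 0 < ε) :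
    ∀ᵐ x ∂μ, ∀ᶠ n : ℕ in atTop, f (T^[n] x) ≤ ε * n := by
  let _ : MeasureSpace α := ⟨μ⟩
  have h1 : (∑' j : ℕ, μ {x | ε⁻¹ * f x ∈ Set.Ioi (j : ℝ)}) < ∞ :=
    tsum_prob_mem_Ioi_lt_top (X := fun x => ε⁻¹ * f x) (hfi.const_mul _)
      fun x => mul_nonneg (inv_nonneg.2 hε.le) (hf0 x)
  have h2 : ∀ j : ℕ, μ {x | ε * j < f (T^[j] x)} = μ {x | ε⁻¹ * f x ∈ Set.Ioi (j : ℝ)} := by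
    intro j
    have hs : MeasurableSet {x | ε⁻¹ * f x ∈ Set.Ioi (j : ℝ)} :=
      (measurable_const.mul hf) measurableSet_Ioi
    rw [← (hT.iterate j).measure_preimage hs.nullMeasurableSet]
    congr 1
    ext x
    simp only [Set.mem_ofPred_eq, Set.mem_Ioi, Set.mem_preimage]
    rw [lt_inv_mul_iff₀ hε]
  -- Borel–Cantelli: by invariance the probabilities are the tails of `f / ε`, summable because `f`
  -- is integrable.
  have h3 := ae_eventually_notMem (μ := μ) (s := fun j : ℕ => {x | ε * j < f (T^[j] x)})
    (by simp_rw [h2]; exact h1.ne)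
  filter_upwards [h3] with x hx
  filter_upwards [hx] with n hn
  exact not_lt.1 hn

end MaximalErgodic

/-! ### Lipschitz coefficients of iterated maps -/

section Lipschitz

variable {E : Type*} [MetricSpace E]

theorem edist_le_lipCoeff_mul (φ : E → E) (x y : E) :
    edist (φ x) (φ y) ≤ lipCoeff φ * edist x y := by
  rcases eq_or_ne x y with rfl | h
  · simp
  · rw [← ENNReal.div_le_iff (edist_pos.2 h).ne' (edist_ne_top x y)]
    exact le_iSup_of_le x (le_iSup_of_le y (le_iSup_of_le h le_rfl))

theorem lipCoeff_le {φ : E → E} {C : ℝ≥0∞}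
    (h : ∀ x y, edist (φ x) (φ y) ≤ C * edist x y) : lipCoeff φ ≤ C :=
  iSup_le fun x => iSup_le fun y => iSup_le fun hxy =>
    (ENNReal.div_le_iff (edist_pos.2 hxy).ne' (edist_ne_top x y)).2 (h x y)

theorem lipCoeff_id_le : lipCoeff (id : E → E) ≤ 1 :=
  lipCoeff_le fun x y => by simp

theorem lipCoeff_comp_le (φ ψ : E → E) : lipCoeff (φ ∘ ψ) ≤ lipCoeff φ * lipCoeff ψ :=
  lipCoeff_le fun x y => (edist_le_lipCoeff_mul φ _ _).trans <| by
    rw [mul_assoc]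
    gcongr
    exact edist_le_lipCoeff_mul ψ x y

/-- The Lipschitz coefficient of a continuous map is determined by its values on a dense set. -/
theorem lipCoeff_eq_iSup_dense {φ : E → E} (hφ : Continuous φ) {S : Set E} (hS : Dense S) :
    lipCoeff φ = ⨆ (x : S) (y : S), edist (φ x) (φ y) / edist (x : E) y := by
  apply le_antisymm
  · set C := ⨆ (x : S) (y : S), edist (φ x) (φ y) / edist (x : E) y with hC
    -- Multiplication by `C` is continuous on `[0, ∞]` only for finite `C`, so the closure argument
    -- needs this case removed.
    rcases eq_or_ne C ∞ with h | h
    · exact h ▸ le_top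
    refine lipCoeff_le fun x y => ?_
    refine isClosed_property2 (p := fun x y => edist (φ x) (φ y) ≤ C * edist x y)
      hS.denseRange_val ?_ ?_ x y
    · refine isClosed_le (by fun_prop) ?_
      exact (ENNReal.continuous_const_mul h).comp (by fun_prop)
    · rintro ⟨x, hx⟩ ⟨y, hy⟩
      rcases eq_or_ne x y with rfl | hxy
      · simp
      · rw [← ENNReal.div_le_iff (edist_pos.2 hxy).ne' (edist_ne_top x y)]
        exact le_iSup_of_le (⟨x, hx⟩ : S) (le_iSup_of_le (⟨y, hy⟩ : S) le_rfl)
  · refine iSup_le fun x => iSup_le fun y => ?_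
    rcases eq_or_ne (x : E) y with h | h
    · simp [h]
    · exact le_iSup_of_le (x : E) (le_iSup_of_le (y : E) (le_iSup_of_le h le_rfl))

theorem measurable_lipCoeff [SecondCountableTopology E] [MeasurableSpace E] [BorelSpace E]
    {W : Type*} [MeasurableSpace W] {φ : W → E → E} (hφ : ∀ w, Continuous (φ w))
    (hm : ∀ s, Measurable fun w => φ w s) : Measurable fun w => lipCoeff (φ w) := by
  obtain ⟨S, hSc, hS⟩ := exists_countable_dense E
  have := hSc.to_subtype
  simp_rw [lipCoeff_eq_iSup_dense (hφ _) hS]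
  refine .iSup fun x => .iSup fun y => ?_
  exact ((hm x).edist (hm y)).div_const _

end Lipschitz

section PastIterate

variable {E : Type*}

theorem pastIterate_add (φ : ℤ → E → E) (t : ℤ) (m n : ℕ) :
    pastIterate φ t (m + n) = pastIterate φ t m ∘ pastIterate φ (t - m) n := by
  induction n with
  | zero => rfl
  | succ n ih =>
    rw [← add_assoc, pastIterate, ih, pastIterate, Function.comp_assoc,
      show t - ((m + n : ℕ) : ℤ) = t - m - n by push_cast; ring]

theorem pastIterate_succ_apply (φ : ℤ → E → E) (t : ℤ) (n : ℕ) (x : E) :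
    pastIterate φ (t + 1) (n + 1) x = φ (t + 1) (pastIterate φ t n x) := by
  rw [add_comm n 1, pastIterate_add]
  simp [pastIterate]

theorem pastIterate_congr {φ ψ : ℤ → E → E} {s t : ℤ} (h : ∀ k : ℕ, φ (s - k) = ψ (t - k)) (n : ℕ) :
    pastIterate φ s n = pastIterate ψ t n := by
  induction n with
  | zero => rfl
  | succ n ih => rw [pastIterate, pastIterate, ih, h]

/-- A solution of `s_{t+1} = φ_t(s_t)` satisfies `s_{t+1} = φ_t^{(n)}(s_{t-n+1})`. -/
theorem eq_pastIterate {φ : ℤ → E → E} {s : ℤ → E} (h : ∀ t, s (t + 1) = φ t (s t)) (t : ℤ)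
    (n : ℕ) : s t = pastIterate φ (t - 1) n (s (t - n)) := by
  induction n with
  | zero => simp [pastIterate]
  | succ n ih =>
    rw [ih, pastIterate, Function.comp_apply, show t - 1 - (n : ℤ) = t - ((n + 1 : ℕ) : ℤ) by
      push_cast; ring, ← h]
    congr 2
    push_cast
    ring

theorem continuous_pastIterate [TopologicalSpace E] {φ : ℤ → E → E} (h : ∀ t, Continuous (φ t))
    (t : ℤ) (n : ℕ) : Continuous (pastIterate φ t n) := by
  induction n with
  | zero => exact continuous_id
  | succ n ih => exact ih.comp (h _)

/-- Each map is measurable in `w` and continuous in the state, hence jointly measurable. The σ-field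
on `W` is left free so that the lemma also serves for the past of the innovations. -/
theorem measurable_pastIterate [MetricSpace E] [SecondCountableTopology E] [MeasurableSpace E]
    [BorelSpace E] {W : Type*} {m : MeasurableSpace W} {φ : ℤ → W → E → E}
    (hφ : ∀ t w, Continuous (φ t w)) {t : ℤ} (hm : ∀ k ≤ t, ∀ s, Measurable fun w => φ k w s)
    (n : ℕ) : ∀ {u : W → E}, Measurable u →
      Measurable fun w => pastIterate (fun k => φ k w) t n (u w) := by
  induction n with
  | zero => exact fun hu => hu
  | succ n ih =>
    intro u hu
    refine ih (u := fun w => φ (t - n) w (u w)) ?_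
    have := measurable_uncurry_of_continuous_of_measurable (u := fun s w => φ (t - n) w s)
      (hφ (t - n)) (hm _ (by omega))
    exact this.comp (hu.prodMk measurable_id)

variable [MetricSpace E]

/-- The Lipschitz coefficient of `φ_{s+n-1} ∘ ⋯ ∘ φ_s`. -/
noncomputable def windowLip (φ : ℤ → E → E) (s : ℤ) (n : ℕ) : ℝ≥0∞ :=
  lipCoeff (pastIterate φ (s + n - 1) n)

theorem windowLip_zero_le (φ : ℤ → E → E) (s : ℤ) : windowLip φ s 0 ≤ 1 := lipCoeff_id_le

theorem windowLip_one (φ : ℤ → E → E) (s : ℤ) : windowLip φ s 1 = lipCoeff (φ s) := by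
  simp [windowLip, pastIterate]

theorem windowLip_add_le (φ : ℤ → E → E) (s : ℤ) (m n : ℕ) :
    windowLip φ s (m + n) ≤ windowLip φ s m * windowLip φ (s + m) n := by
  rw [windowLip, add_comm m n, pastIterate_add, mul_comm]
  refine (lipCoeff_comp_le _ _).trans (le_of_eq ?_)
  rw [windowLip, windowLip]
  congr 3 <;> push_cast <;> ring

end PastIterate

/-! ### Submultiplicative arrays -/

section Submultiplicative

/-- The exponential with values in `[0, ∞]`. -/
noncomputable def expE (x : ℝ) : ℝ≥0∞ := ENNReal.ofReal (Real.exp x)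

theorem expE_zero : expE 0 = 1 := by simp [expE]

theorem expE_add (x y : ℝ) : expE (x + y) = expE x * expE y := by
  rw [expE, Real.exp_add, ENNReal.ofReal_mul (Real.exp_nonneg _), expE, expE]

theorem expE_mono {x y : ℝ} (h : x ≤ y) : expE x ≤ expE y :=
  ENNReal.ofReal_le_ofReal (Real.exp_le_exp.2 h)

theorem expE_nsmul (n : ℕ) (x : ℝ) : expE (n * x) = expE x ^ n := by
  rw [expE, Real.exp_nat_mul, ENNReal.ofReal_pow (Real.exp_nonneg _), expE]

theorem expE_sum {ι : Type*} (s : Finset ι) (f : ι → ℝ) :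
    expE (∑ i ∈ s, f i) = ∏ i ∈ s, expE (f i) := by
  rw [expE, Real.exp_sum, ENNReal.ofReal_prod_of_nonneg fun i _ => Real.exp_nonneg _]
  rfl

variable {L : ℤ → ℕ → ℝ≥0∞} {a b : ℤ → ℝ} {r : ℕ}

theorem submul_le_expE_sum (hL0 : ∀ s, L s 0 ≤ 1)
    (hL : ∀ s m n, L s (m + n) ≤ L s m * L (s + m) n) (hb : ∀ s, L s 1 ≤ expE (b s))
    (s : ℤ) (n : ℕ) : L s n ≤ expE (∑ i ∈ Finset.range n, b (s + i)) := by
  induction n with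
  | zero => simpa [expE_zero] using hL0 s
  | succ n ih =>
    rw [Finset.sum_range_succ, expE_add]
    exact (hL s n 1).trans (mul_le_mul' ih (hb _))

/-- Since `b ≥ 0`, completing a fragment to the full block of length `r` only enlarges the bound.
One edge term thus controls every incomplete block, whatever the offset. -/
theorem submul_subwindow_le (hL0 : ∀ s, L s 0 ≤ 1)
    (hL : ∀ s m n, L s (m + n) ≤ L s m * L (s + m) n) (hb : ∀ s, L s 1 ≤ expE (b s))
    (hb0 : ∀ s, 0 ≤ b s) (s : ℤ) {i l : ℕ} (h : i + l ≤ r) :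
    L (s + i) l ≤ expE (∑ j ∈ Finset.range r, b (s + j)) := by
  refine (submul_le_expE_sum hL0 hL hb _ _).trans (expE_mono ?_)
  have : ∑ j ∈ Finset.range l, b (s + i + j) = ∑ j ∈ Finset.Ico i (i + l), b (s + j) := by
    rw [Finset.sum_Ico_eq_sum_range]
    simp [add_assoc]
  rw [this]
  refine Finset.sum_le_sum_of_subset_of_nonneg (fun j hj => ?_) fun j _ _ => hb0 _
  simp only [Finset.mem_Ico, Finset.mem_range] at hj ⊢
  omega

/-- Passing from `n` to `n + 1` replaces the factor `L s n` by `L s (n + r)`, which costs exactly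
one block factor `L (s + n) r`. -/
theorem submul_prod_le (hr : 1 ≤ r) (hL : ∀ s m n, L s (m + n) ≤ L s m * L (s + m) n) (s : ℤ) (n : ℕ) :
    ∏ i ∈ Finset.range r, L s (n + i) ≤
      (∏ i ∈ Finset.range r, L s i) * ∏ m ∈ Finset.range n, L (s + m) r := by
  induction n with
  | zero => simp
  | succ n ih =>
    rw [Finset.prod_range_succ, ← mul_assoc]
    refine le_trans ?_ (mul_le_mul' ih le_rfl)
    cases r with
    | zero => omega
    | succ r =>
      rw [Finset.prod_range_succ, Finset.prod_range_succ' (fun i => L s (n + i)), mul_assoc]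
      refine mul_le_mul' (le_of_eq ?_) ?_
      · exact Finset.prod_congr rfl fun i _ => by rw [add_assoc, add_comm 1]
      · rw [add_assoc, add_comm 1]
        exact hL s n (r + 1)

/-- Averaging over the `r` ways of cutting a window into blocks of length `r`. -/
theorem submul_le_expE (hr : 1 ≤ r) (hL0 : ∀ s, L s 0 ≤ 1)
    (hL : ∀ s m n, L s (m + n) ≤ L s m * L (s + m) n) (hb : ∀ s, L s 1 ≤ expE (b s))
    (hb0 : ∀ s, 0 ≤ b s) (ha : ∀ s, L s r ≤ expE (a s)) (s : ℤ) (n : ℕ) :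
    L s (n + r) ≤ expE (∑ j ∈ Finset.range r, b (s + j) + ∑ j ∈ Finset.range r, b (s + n + j) +
      (∑ m ∈ Finset.range n, a (s + m)) / r) := by
  set c : ℤ → ℝ := fun s => ∑ j ∈ Finset.range r, b (s + j) with hc
  have hr0 : (r : ℝ) ≠ 0 := by positivity
  rw [← ENNReal.pow_le_pow_left_iff (n := r) (by omega), ← expE_nsmul]
  calc L s (n + r) ^ r = ∏ i ∈ Finset.range r, L s (n + r) := by simp
    -- The `i`-th copy of the window is cut after `n + i` steps; the remaining `r - i` steps lie in
    -- the block starting at `s + n`.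
    _ ≤ ∏ i ∈ Finset.range r, (L s (n + i) * expE (c (s + n))) := by
      refine Finset.prod_le_prod' fun i hi => ?_
      have hi' := Finset.mem_range.1 hi
      have h1 := hL s (n + i) (r - i)
      rw [show n + i + (r - i) = n + r by omega] at h1
      refine h1.trans (mul_le_mul' le_rfl ?_)
      have := submul_subwindow_le hL0 hL hb hb0 (s + n) (i := i) (l := r - i) (r := r) (by omega)
      rwa [add_assoc, ← Nat.cast_add] at this
    _ = (∏ i ∈ Finset.range r, L s (n + i)) * expE (c (s + n)) ^ r := by
      rw [Finset.prod_mul_distrib]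
      simp
    _ ≤ (expE (c s) ^ r * expE (∑ m ∈ Finset.range n, a (s + m))) * expE (c (s + n)) ^ r := by
      gcongr
      refine (submul_prod_le hr hL s n).trans (mul_le_mul' ?_ ?_)
      · calc ∏ i ∈ Finset.range r, L s i ≤ ∏ i ∈ Finset.range r, expE (c s) :=
              Finset.prod_le_prod' fun i hi => by
                have := submul_subwindow_le hL0 hL hb hb0 s (i := 0) (l := i) (r := r)
                  (by have := Finset.mem_range.1 hi; omega)
                simpa using this
          _ = _ := by simp
      · rw [expE_sum]
        exact Finset.prod_le_prod' fun i _ => ha _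
    _ = _ := by
      rw [← expE_nsmul, ← expE_nsmul, ← expE_add, ← expE_add]
      congr 1
      field_simp
      ring

end Submultiplicative

/-! ### Logarithmic moments -/

section LogMoments

/-- Finiteness of `log⁺ y` excludes `y = ∞`, and truncating `log⁻ y` only weakens the bound. `M = 0`
keeps just `log⁺`; a large finite `M` keeps enough negative mass without requiring `log⁻` to be
integrable. -/
theorem le_expE_logPos_sub_logNeg {y : ℝ≥0∞} (hy : logPos y ≠ ∞) {M : ℝ≥0∞} :
    y ≤ expE ((logPos y).toReal - (min (logNeg y) M).toReal) := by
  rcases eq_or_ne y 0 with rfl | h0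
  · exact zero_le
  rcases eq_or_ne y ∞ with rfl | htop
  · simp [logPos] at hy
  obtain ⟨x, hx, rfl⟩ : ∃ x : ℝ, 0 < x ∧ y = ENNReal.ofReal x :=
    ⟨y.toReal, ENNReal.toReal_pos h0 htop, (ENNReal.ofReal_toReal htop).symm⟩
  have h1 : (logPos (ENNReal.ofReal x)).toReal = max (Real.log x) 0 := by
    rw [logPos, ENNReal.log_ofReal_of_pos hx, EReal.real_coe_toENNReal, ENNReal.toReal_ofReal']
  have h2 : logNeg (ENNReal.ofReal x) = ENNReal.ofReal (-Real.log x) := by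
    rw [logNeg, ENNReal.log_ofReal_of_pos hx, ← EReal.coe_neg, EReal.real_coe_toENNReal]
  have h3 : (min (logNeg (ENNReal.ofReal x)) M).toReal ≤ max (-Real.log x) 0 := by
    rw [← ENNReal.toReal_ofReal', ← h2]
    exact ENNReal.toReal_mono (by rw [h2]; exact ENNReal.ofReal_ne_top) (min_le_left _ _)
  conv_lhs => rw [← Real.exp_log hx]
  refine expE_mono ?_
  rw [h1]
  rcases le_total (Real.log x) 0 with h | h
  · rw [max_eq_left (by linarith : (0 : ℝ) ≤ -Real.log x)] at h3
    rw [max_eq_right h]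
    linarith
  · rw [max_eq_right (by linarith : -Real.log x ≤ 0)] at h3
    rw [max_eq_left h]
    linarith

theorem measurable_logPos : Measurable logPos := ENNReal.measurable_log.ereal_toENNReal

theorem measurable_logNeg : Measurable logNeg := ENNReal.measurable_log.neg.ereal_toENNReal

variable {W : Type*} [MeasurableSpace W] {μ : Measure W} {Y : W → ℝ≥0∞}

theorem finiteLogPosMoment_map_iff {Ω : Type*} [MeasurableSpace Ω] {P : Measure Ω} {π : Ω → W}
    (hπ : Measurable π) (hY : Measurable Y) :
    FiniteLogPosMoment (P.map π) Y ↔ FiniteLogPosMoment P fun ω => Y (π ω) := by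
  rw [FiniteLogPosMoment, FiniteLogPosMoment,
    lintegral_map (f := fun w => logPos (Y w)) (measurable_logPos.comp hY) hπ]

theorem negativeLogMean_map_iff {Ω : Type*} [MeasurableSpace Ω] {P : Measure Ω} {π : Ω → W}
    (hπ : Measurable π) (hY : Measurable Y) :
    NegativeLogMean (P.map π) Y ↔ NegativeLogMean P fun ω => Y (π ω) := by
  rw [NegativeLogMean, NegativeLogMean,
    lintegral_map (f := fun w => logPos (Y w)) (measurable_logPos.comp hY) hπ,
    lintegral_map (f := fun w => logNeg (Y w)) (measurable_logNeg.comp hY) hπ]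

theorem FiniteLogPosMoment.exists_le_expE (hY : Measurable Y) (h : FiniteLogPosMoment μ Y) :
    ∃ b : W → ℝ, Measurable b ∧ Integrable b μ ∧ 0 ≤ b ∧ ∀ᵐ w ∂μ, Y w ≤ expE (b w) := by
  have hm : Measurable fun w => logPos (Y w) := measurable_logPos.comp hY
  refine ⟨fun w => (logPos (Y w)).toReal, hm.ennreal_toReal,
    integrable_toReal_of_lintegral_ne_top hm.aemeasurable h.ne, fun w => ENNReal.toReal_nonneg, ?_⟩
  filter_upwards [ae_lt_top hm h.ne] with w hw
  simpa using le_expE_logPos_sub_logNeg hw.ne (M := 0)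

theorem NegativeLogMean.exists_le_expE [IsFiniteMeasure μ] (hY : Measurable Y)
    (h : NegativeLogMean μ Y) :
    ∃ a : W → ℝ, Measurable a ∧ Integrable a μ ∧ ∫ w, a w ∂μ < 0 ∧
      ∀ᵐ w ∂μ, Y w ≤ expE (a w) := by
  have hm : Measurable fun w => logPos (Y w) := measurable_logPos.comp hY
  have hn : Measurable fun w => logNeg (Y w) := measurable_logNeg.comp hY
  have hfin : ∫⁻ w, logPos (Y w) ∂μ ≠ ∞ := h.ne_top
  -- Monotone convergence in the truncation level: the strict inequality survives at some finite
  -- `M`, even if `E[log Y] = -∞`.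
  obtain ⟨M, hM⟩ : ∃ M : ℕ, ∫⁻ w, logPos (Y w) ∂μ < ∫⁻ w, min (logNeg (Y w)) M ∂μ := by
    have hsup : ∫⁻ w, logNeg (Y w) ∂μ = ⨆ M : ℕ, ∫⁻ w, min (logNeg (Y w)) M ∂μ := by
      rw [← lintegral_iSup (fun M => hn.min measurable_const)]
      · congr 1
        ext w
        rw [← inf_iSup_eq, ENNReal.iSup_natCast, inf_top_eq]
      · intro M N hMN w
        simp only
        gcongr
    unfold NegativeLogMean at h
    rw [hsup] at h
    exact lt_iSup_iff.1 h
  have hnM : Measurable fun w => min (logNeg (Y w)) (M : ℝ≥0∞) := hn.min measurable_const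
  have hfinM : ∫⁻ w, min (logNeg (Y w)) M ∂μ ≠ ∞ := by
    refine ((lintegral_mono fun w => min_le_right _ _).trans_lt ?_).ne (b := ∞)
    rw [lintegral_const]
    exact ENNReal.mul_lt_top (ENNReal.natCast_lt_top M) (measure_lt_top _ _)
  have i1 := integrable_toReal_of_lintegral_ne_top hm.aemeasurable hfin
  have i2 := integrable_toReal_of_lintegral_ne_top hnM.aemeasurable hfinM
  refine ⟨fun w => (logPos (Y w)).toReal - (min (logNeg (Y w)) M).toReal,
    hm.ennreal_toReal.sub hnM.ennreal_toReal, i1.sub i2, ?_, ?_⟩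
  · rw [integral_sub i1 i2, integral_toReal hm.aemeasurable (ae_lt_top hm hfin),
      integral_toReal hnM.aemeasurable (ae_lt_top hnM hfinM), sub_neg]
    exact (ENNReal.toReal_lt_toReal hfin hfinM).2 hM
  · filter_upwards [ae_lt_top hm hfin] with w hw
    exact le_expE_logPos_sub_logNeg hw.ne

end LogMoments

/-! ### Shifts on the path space -/

section Shift

variable {F : Type*}

/-- The shift of a path by `t ∈ ℤ`. -/
def shiftBy (t : ℤ) (w : ℤ → F) : ℤ → F := fun k => w (k + t)

theorem shiftBy_shiftBy (s t : ℤ) (w : ℤ → F) : shiftBy s (shiftBy t w) = shiftBy (s + t) w := by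
  ext k
  simp [shiftBy, add_assoc]

theorem shiftBy_zero (w : ℤ → F) : shiftBy 0 w = w := by
  ext k
  simp [shiftBy]

theorem shift_iterate (n : ℕ) (w : ℤ → F) : shift^[n] w = shiftBy n w := by
  induction n with
  | zero => exact (shiftBy_zero w).symm
  | succ n ih =>
    rw [Function.iterate_succ_apply', ih]
    refine (shiftBy_shiftBy 1 n w).trans ?_
    rw [add_comm, Nat.cast_succ]

variable {E : Type*}

/-- The stationary sequence of maps `φ_t = ψ ∘ θ^t`, with `θ` the shift. -/
def shiftedMaps (ψ : (ℤ → F) → E → E) (w : ℤ → F) (t : ℤ) : E → E := ψ (shiftBy t w)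

theorem pastIterate_shiftedMaps (ψ : (ℤ → F) → E → E) (w : ℤ → F) (s t : ℤ) (n : ℕ) :
    pastIterate (shiftedMaps ψ w) (s + t) n = pastIterate (shiftedMaps ψ (shiftBy t w)) s n := by
  refine pastIterate_congr (fun k => ?_) n
  rw [shiftedMaps, shiftedMaps, shiftBy_shiftBy]
  congr 2
  ring

variable [MeasurableSpace F]

theorem measurable_shiftBy (t : ℤ) : Measurable (shiftBy (F := F) t) :=
  measurable_pi_lambda _ fun _ => measurable_pi_apply _

/-- The time shift as an automorphism of the path space. -/
def shiftEquiv (F : Type*) [MeasurableSpace F] : (ℤ → F) ≃ᵐ (ℤ → F) where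
  toFun := shift
  invFun := shiftBy (-1)
  left_inv w := (shiftBy_shiftBy (-1) 1 w).trans (shiftBy_zero w)
  right_inv w := (shiftBy_shiftBy 1 (-1) w).trans (shiftBy_zero w)
  measurable_toFun := measurable_shiftBy 1
  measurable_invFun := measurable_shiftBy (-1)

theorem shiftEquiv_symm_iterate (n : ℕ) (w : ℤ → F) :
    (shiftEquiv F).symm^[n] w = shiftBy (-n) w := by
  induction n with
  | zero => exact (shiftBy_zero w).symm
  | succ n ih =>
    rw [Function.iterate_succ_apply', ih]
    refine (shiftBy_shiftBy (-1) (-n) w).trans ?_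
    congr 1
    push_cast
    ring

theorem measurePreserving_shiftBy {μ : Measure (ℤ → F)} (h : MeasurePreserving shift μ μ) (t : ℤ) :
    MeasurePreserving (shiftBy t) μ μ := by
  obtain ⟨n, rfl | rfl⟩ := t.eq_nat_or_neg
  · convert! h.iterate n using 1
    exact funext fun w => (shift_iterate n w).symm
  · have h' : MeasurePreserving (shiftEquiv F) μ μ := h
    convert! (h'.symm _).iterate n using 1
    exact funext fun w => (shiftEquiv_symm_iterate n w).symm

end Shift

/-! ### Exponential contraction along stationary ergodic sequences of random maps -/

section Contraction

variable {F : Type*} [MeasurableSpace F] {μ : Measure (ℤ → F)}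

theorem ae_shiftBy (h : MeasurePreserving shift μ μ) {p : (ℤ → F) → Prop} (hp : ∀ᵐ w ∂μ, p w) :
    ∀ᵐ w ∂μ, ∀ t, p (shiftBy t w) :=
  ae_all_iff.2 fun t => (measurePreserving_shiftBy h t).quasiMeasurePreserving.ae hp

/-- Apply the boundedness of Birkhoff sums to `a + δ`, whose mean is still negative. This one-sided
linear bound replaces the ergodic theorem. -/
theorem ae_exists_birkhoffSum_le {W : Type*} [MeasurableSpace W] {ν : Measure W}
    [IsProbabilityMeasure ν] {T : W → W} (hT : Ergodic T ν) {a : W → ℝ}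
    (ha : Measurable a) (hai : Integrable a ν) {δ : ℝ} (hδ : ∫ w, a w ∂ν < -δ) :
    ∀ᵐ w ∂ν, ∃ C : ℝ, ∀ n : ℕ, birkhoffSum T a n w ≤ C - δ * n := by
  have hneg : ∫ w, (a w + δ) ∂ν < 0 := by
    rw [integral_add hai (integrable_const _)]
    simp
    linarith
  filter_upwards [ae_bddAbove_birkhoffSum hT (ha.add_const δ) (hai.add (integrable_const _)) hneg]
    with w hw
  obtain ⟨C, hC⟩ := hw
  refine ⟨C, fun n => ?_⟩
  have h1 : birkhoffSum T (fun w => a w + δ) n w ≤ C := hC ⟨n, rfl⟩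
  have h2 : birkhoffSum T (fun w => a w + δ) n w = birkhoffSum T a n w + n * δ := by
    simp [birkhoffSum, Finset.sum_add_distrib]
  linarith

variable [IsProbabilityMeasure μ]

theorem ae_eventually_shiftBy_le (h : MeasurePreserving shift μ μ) {c : (ℤ → F) → ℝ}
    (hc : Measurable c) (hci : Integrable c μ) (hc0 : 0 ≤ c) {ε : ℝ} (hε : 0 < ε) :
    (∀ᵐ w ∂μ, ∀ᶠ n : ℕ in atTop, c (shiftBy n w) ≤ ε * n) ∧
      ∀ᵐ w ∂μ, ∀ᶠ n : ℕ in atTop, c (shiftBy (-n) w) ≤ ε * n := by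
  constructor
  · simpa only [shift_iterate] using ae_eventually_iterate_le h hc hci hc0 hε
  · have h' : MeasurePreserving (shiftEquiv F) μ μ := h
    simpa only [shiftEquiv_symm_iterate] using
      ae_eventually_iterate_le (h'.symm _) hc hci hc0 hε

/-- The drift is `δ / r`. A quarter absorbs the moving edge term `u`, another quarter the constants,
and half remains; the extra `δ / 2` pays for the index shift by `r`. -/
theorem eventually_le_of_linear_bounds {r : ℕ} (hr : 1 ≤ r) {δ C D : ℝ} (hδ : 0 < δ)
    {y u v : ℕ → ℝ} (hu : ∀ᶠ n in atTop, u n ≤ δ / (4 * r) * n) (hv : ∀ n : ℕ, v n ≤ C - δ * n)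
    (hy : ∀ n, y (n + r) = D + u n + v n / r) :
    ∀ᶠ n in atTop, y n ≤ -(δ / (2 * r)) * n := by
  have hr0 : (0 : ℝ) < r := by positivity
  have ht : Tendsto (fun n : ℕ => δ / (4 * r) * (n : ℝ)) atTop atTop :=
    tendsto_natCast_atTop_atTop.const_mul_atTop (by positivity)
  rw [← map_add_atTop_eq_nat r, eventually_map]
  filter_upwards [hu, ht.eventually_ge_atTop (D + C / r + δ / 2)] with n h1 h2
  rw [hy]
  have h3 : v n / r ≤ (C - δ * n) / r := by gcongr; exact hv n
  have h4 : (C - δ * n) / r = C / r - 4 * (δ / (4 * r) * n) := by field_simp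
  have h5 : -(δ / (2 * r)) * ((n + r : ℕ) : ℝ) = - 2 * (δ / (4 * r) * n) - δ / 2 := by
    push_cast
    field_simp
    ring
  rw [h5]
  linarith

variable {E : Type*} [MetricSpace E]

/-- If `E log⁺ Λ(φ_0) < ∞` and `E log Λ(φ_0^{(r)}) < 0` for some `r`, then the Lipschitz
coefficients of the forward and of the backward iterates decay exponentially fast. -/
theorem exists_exponential_contraction (hT : Ergodic shift μ) {ψ : (ℤ → F) → E → E} {r : ℕ}
    (hr : 1 ≤ r) (hm : Measurable fun w => lipCoeff (ψ w))
    (hmr : Measurable fun w => lipCoeff (pastIterate (shiftedMaps ψ w) 0 r))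
    (hpos : FiniteLogPosMoment μ fun w => lipCoeff (ψ w))
    (hneg : NegativeLogMean μ fun w => lipCoeff (pastIterate (shiftedMaps ψ w) 0 r)) :
    ∃ κ : ℝ, 0 < κ ∧
      (∀ᵐ w ∂μ, ∀ᶠ n : ℕ in atTop,
        lipCoeff (pastIterate (shiftedMaps ψ w) (n - 1) n) ≤ expE (-κ * n)) ∧
      ∀ᵐ w ∂μ, ∀ᶠ n : ℕ in atTop,
        lipCoeff (pastIterate (shiftedMaps ψ w) (-1) n) ≤ expE (-κ * n) := by
  obtain ⟨b, hbm, hbi, hb0, hb⟩ := hpos.exists_le_expE hm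
  obtain ⟨a, ham, hai, haneg, ha⟩ := hneg.exists_le_expE hmr
  have hmp := hT.toMeasurePreserving
  have hTs : Ergodic (shiftEquiv F).symm μ := Ergodic.symm (e := shiftEquiv F) hT
  have hr0 : (0 : ℝ) < r := by positivity
  set c : (ℤ → F) → ℝ := fun w => ∑ j ∈ Finset.range r, b (shiftBy j w) with hc
  have hcm : Measurable c := Finset.measurable_fun_sum _ fun j _ => hbm.comp (measurable_shiftBy _)
  have hci : Integrable c μ := integrable_finsetSum _ fun j _ =>
    (measurePreserving_shiftBy hmp j).integrable_comp_of_integrable hbi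
  have hc0 : 0 ≤ c := fun w => Finset.sum_nonneg fun j _ => hb0 _
  obtain ⟨δ, hδ, haδ⟩ : ∃ δ : ℝ, 0 < δ ∧ ∫ w, a w ∂μ < -δ :=
    ⟨-(∫ w, a w ∂μ) / 2, by linarith, by linarith⟩
  -- `a` bounds the block of length `r` ending at time 0, whereas windows are indexed by their left
  -- end; hence the offset `r - 1`.
  have key : ∀ᵐ w ∂μ, ∀ (s : ℤ) (n : ℕ), windowLip (shiftedMaps ψ w) s (n + r) ≤
      expE (c (shiftBy s w) + c (shiftBy (s + n) w) +
        (∑ m ∈ Finset.range n, a (shiftBy (s + m + (r - 1)) w)) / r) := by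
    filter_upwards [ae_shiftBy hmp hb, ae_shiftBy hmp ha] with w h1 h2
    intro s n
    have := submul_le_expE (L := windowLip (shiftedMaps ψ w)) (b := fun s => b (shiftBy s w))
      (a := fun s => a (shiftBy (s + (r - 1)) w)) hr (windowLip_zero_le _) (windowLip_add_le _)
      (fun s => by rw [windowLip_one]; exact h1 s) (fun s => hb0 _) (fun s => ?_) s n
    · refine this.trans (le_of_eq ?_)
      simp only [hc, shiftBy_shiftBy, add_comm]
    · have := h2 (s + (r - 1))
      rw [← pastIterate_shiftedMaps, zero_add] at this
      rw [windowLip, add_sub_assoc]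
      exact this
  have hεr : 0 < δ / (4 * r) := by positivity
  obtain ⟨gf, gb⟩ := ae_eventually_shiftBy_le hmp hcm hci hc0 hεr
  refine ⟨δ / (2 * r), by positivity, ?_, ?_⟩
  · have hB := (measurePreserving_shiftBy hmp (r - 1)).quasiMeasurePreserving.ae
      (ae_exists_birkhoffSum_le hT ham hai haδ)
    filter_upwards [key, gf, hB] with w hk hg hB
    obtain ⟨C, hC⟩ := hB
    have := eventually_le_of_linear_bounds (r := r) hr hδ (D := c w) (C := C)
      (y := fun N => c w + c (shiftBy (N - r) w) +
        birkhoffSum shift a (N - r) (shiftBy (r - 1) w) / r)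
      (u := fun n => c (shiftBy n w)) (v := fun n => birkhoffSum shift a n (shiftBy (r - 1) w))
      hg hC (fun n => by simp)
    filter_upwards [this, eventually_ge_atTop r] with N hN hNr
    obtain ⟨n, rfl⟩ := Nat.exists_eq_add_of_le' hNr
    have h1 := hk 0 n
    rw [windowLip, zero_add, zero_add, shiftBy_zero] at h1
    refine h1.trans (expE_mono (le_trans (le_of_eq ?_) hN))
    simp [birkhoffSum, shift_iterate, shiftBy_shiftBy]
  -- For the window from `-(n + r)` to `-1` the block ends entering the sum run from `-(n + 1)` to
  -- `-2`. Read backward, this is a Birkhoff sum of the inverse shift started at `-2`; the edge at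
  -- `-r` stays fixed and the one at `-(n + r)` moves.
  · have hB := (measurePreserving_shiftBy hmp (-2)).quasiMeasurePreserving.ae
      (ae_exists_birkhoffSum_le hTs ham hai haδ)
    have hg := (measurePreserving_shiftBy hmp (-r)).quasiMeasurePreserving.ae gb
    filter_upwards [key, hg, hB] with w hk hg hB
    obtain ⟨C, hC⟩ := hB
    have := eventually_le_of_linear_bounds (r := r) hr hδ (D := c (shiftBy (-r) w)) (C := C)
      (y := fun N => c (shiftBy (-r) w) + c (shiftBy (-(N - r : ℕ)) (shiftBy (-r) w)) +
        birkhoffSum (shiftEquiv F).symm a (N - r) (shiftBy (-2) w) / r)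
      (u := fun n => c (shiftBy (-n) (shiftBy (-r) w)))
      (v := fun n => birkhoffSum (shiftEquiv F).symm a n (shiftBy (-2) w))
      hg hC (fun n => by simp)
    filter_upwards [this, eventually_ge_atTop r] with N hN hNr
    obtain ⟨n, rfl⟩ := Nat.exists_eq_add_of_le' hNr
    have h1 := hk (-(n + r : ℕ)) n
    rw [windowLip, neg_add_cancel, zero_sub] at h1
    refine h1.trans (expE_mono (le_trans (le_of_eq ?_) hN))
    rw [Nat.add_sub_cancel, shiftBy_shiftBy, ← Finset.sum_range_reflect,
      show -((n + r : ℕ) : ℤ) + n = -r by push_cast; ring,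
      show -(n : ℤ) + -r = -((n + r : ℕ) : ℤ) by push_cast; ring, add_comm (c (shiftBy (-r) w))]
    simp only [birkhoffSum, shiftEquiv_symm_iterate, shiftBy_shiftBy]
    congr 2
    refine Finset.sum_congr rfl fun k hk => ?_
    have := Finset.mem_range.1 hk
    congr 2
    omega

end Contraction

/-! ### The stationary solution of a contracting stochastic recurrence equation -/

section StationarySolution

variable {F E : Type*} [MetricSpace E]

section BackwardLimit

variable [Nonempty E]

/-- The limit of the backward iterates `φ_{t-1} ∘ ⋯ ∘ φ_{t-n}(x₀)`. -/
noncomputable def backwardLimit (ψ : (ℤ → F) → E → E) (x₀ : E) (t : ℤ) (w : ℤ → F) : E :=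
  limUnder atTop fun n : ℕ => pastIterate (shiftedMaps ψ w) (t - 1) n x₀

theorem backwardLimit_shift (ψ : (ℤ → F) → E → E) (x₀ : E) (t : ℤ) (w : ℤ → F) :
    backwardLimit ψ x₀ t (shift w) = backwardLimit ψ x₀ (t + 1) w := by
  rw [backwardLimit, backwardLimit, show t + 1 - 1 = t - 1 + 1 by ring]
  simp_rw [pastIterate_shiftedMaps ψ w (t - 1) 1]
  rfl

/-- `limUnder` takes a fixed value where there is no convergence, so the limit is measurable for
whatever σ-field makes the maps up to time `t - 1` measurable, without completing it. -/
theorem measurable_backwardLimit [CompleteSpace E] [SecondCountableTopology E] [MeasurableSpace E]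
    [BorelSpace E] {Ω : Type*} {m : MeasurableSpace Ω} {π : Ω → ℤ → F} {ψ : (ℤ → F) → E → E}
    (hψ : ∀ w, Continuous (ψ w)) (x₀ : E) {t : ℤ}
    (hm : ∀ k ≤ t - 1, ∀ s, Measurable fun ω => shiftedMaps ψ (π ω) k s) :
    Measurable fun ω => backwardLimit ψ x₀ t (π ω) := by
  refine (StronglyMeasurable.limUnder fun n => ?_).measurable
  exact (measurable_pastIterate (φ := fun k ω => shiftedMaps ψ (π ω) k) (fun t w => hψ _) hm n
    measurable_const).stronglyMeasurable

theorem backwardLimit_succ {ψ : (ℤ → F) → E → E} (hψ : ∀ w, Continuous (ψ w)) {x₀ : E}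
    {w : ℤ → F} (h : ∀ t : ℤ, ∃ x, Tendsto
      (fun n : ℕ => pastIterate (shiftedMaps ψ w) (t - 1) n x₀) atTop (𝓝 x)) (t : ℤ) :
    backwardLimit ψ x₀ (t + 1) w = shiftedMaps ψ w t (backwardLimit ψ x₀ t w) := by
  have h1 := (tendsto_nhds_limUnder (h (t + 1))).comp (tendsto_add_atTop_nat 1)
  have h2 := ((hψ (shiftBy t w)).tendsto _).comp (tendsto_nhds_limUnder (h t))
  refine tendsto_nhds_unique h1 (h2.congr fun n => ?_)
  have := pastIterate_succ_apply (shiftedMaps ψ w) (t - 1) n x₀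
  rw [sub_add_cancel] at this
  simp only [Function.comp_apply]
  rw [add_sub_cancel_right, this]
  rfl

end BackwardLimit

variable [MeasurableSpace F] {μ : Measure (ℤ → F)} [IsProbabilityMeasure μ]


/-- Consecutive backward iterates are images, under the same contracting composition, of `x₀` and of
one new map applied to `x₀`. The log-moment lets the latter drift at most like `e^{κn/2}`, so
increments are of order `e^{-κn/2}` and summable. The reference point `x₁` is separate because the
moment condition measures distance to the zero function, while the iteration starts at `ς`. -/
theorem ae_exists_tendsto_backward [CompleteSpace E] (hT : Ergodic shift μ)
    {ψ : (ℤ → F) → E → E} {x₀ x₁ : E} (hm : Measurable fun w => edist (ψ w x₀) x₁)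
    (hpos : FiniteLogPosMoment μ fun w => edist (ψ w x₀) x₁) {κ : ℝ} (hκ : 0 < κ)
    (hc : ∀ᵐ w ∂μ, ∀ᶠ n : ℕ in atTop,
      lipCoeff (pastIterate (shiftedMaps ψ w) (-1) n) ≤ expE (-κ * n)) :
    ∀ᵐ w ∂μ, ∀ t : ℤ, ∃ x, Tendsto
      (fun n : ℕ => pastIterate (shiftedMaps ψ w) (t - 1) n x₀) atTop (𝓝 x) := by
  have hmp := hT.toMeasurePreserving
  suffices h0 : ∀ᵐ w ∂μ, ∃ x, Tendsto
      (fun n : ℕ => pastIterate (shiftedMaps ψ w) (-1) n x₀) atTop (𝓝 x) by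
    filter_upwards [ae_shiftBy hmp h0] with w hw t
    have := hw t
    simp_rw [← pastIterate_shiftedMaps] at this
    rwa [neg_add_eq_sub] at this
  obtain ⟨b, hbm, hbi, hb0, hb⟩ := hpos.exists_le_expE hm
  have hg := (measurePreserving_shiftBy hmp (-1)).quasiMeasurePreserving.ae
    (ae_eventually_shiftBy_le hmp hbm hbi hb0 (half_pos hκ)).2
  filter_upwards [hc, ae_shiftBy hmp hb, hg] with w h1 h2 h3
  refine cauchySeq_tendsto_of_complete (cauchySeq_of_summable_dist ?_)
  set C := dist x₁ x₀
  have hsum : Summable fun n : ℕ => Real.exp (-(κ / 2)) ^ n * (1 + C) :=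
    (summable_geometric_of_lt_one (Real.exp_nonneg _)
      (Real.exp_lt_one_iff.2 (by linarith))).mul_right _
  refine Summable.of_norm_bounded_eventually_nat hsum ?_
  filter_upwards [h1, h3] with n hn1 hn3
  rw [Real.norm_of_nonneg dist_nonneg]
  have e1 : edist (ψ (shiftBy (-1 - n) w) x₀) x₁ ≤ expE (κ / 2 * n) := by
    refine (h2 (-1 - n)).trans (expE_mono ?_)
    rw [shiftBy_shiftBy] at hn3
    rwa [show (-1 : ℤ) - n = -n + -1 by ring]
  have e2 : edist (pastIterate (shiftedMaps ψ w) (-1) n x₀)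
      (pastIterate (shiftedMaps ψ w) (-1) (n + 1) x₀) ≤
      ENNReal.ofReal (Real.exp (-(κ / 2)) ^ n * (1 + C)) := by
    calc _ ≤ lipCoeff (pastIterate (shiftedMaps ψ w) (-1) n) *
          edist x₀ (shiftedMaps ψ w (-1 - n) x₀) := edist_le_lipCoeff_mul _ _ _
      _ ≤ expE (-κ * n) * (expE (κ / 2 * n) + ENNReal.ofReal C) := by
        gcongr
        rw [edist_comm, ← edist_dist]
        exact (edist_triangle _ x₁ _).trans (add_le_add e1 le_rfl)
      _ = ENNReal.ofReal (Real.exp (-κ * n) * (Real.exp (κ / 2 * n) + C)) := by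
        rw [expE, expE, ← ENNReal.ofReal_add (Real.exp_nonneg _) dist_nonneg,
          ← ENNReal.ofReal_mul (Real.exp_nonneg _)]
      _ ≤ _ := by
        refine ENNReal.ofReal_le_ofReal ?_
        have e3 : Real.exp (-κ * n) ≤ Real.exp (-(κ / 2)) ^ n := by
          rw [← Real.exp_nat_mul]
          refine Real.exp_le_exp.2 ?_
          have : (0 : ℝ) ≤ κ * n := by positivity
          linarith
        have e4 : Real.exp (-κ * n) * Real.exp (κ / 2 * n) = Real.exp (-(κ / 2)) ^ n := by
          rw [← Real.exp_nat_mul, ← Real.exp_add]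
          congr 1
          ring
        rw [mul_add, e4, mul_add, mul_one]
        gcongr
  rw [edist_dist] at e2
  exact (ENNReal.ofReal_le_ofReal_iff (by have : 0 ≤ C := dist_nonneg; positivity)).1 e2

end StationarySolution

/-! ### Comparison of stationary sequences through vanishing Lipschitz coefficients -/

section Comparison

variable {Ω : Type*} [MeasurableSpace Ω] {P : Measure Ω}

/-- Where `x ≠ 0` and `l n → 0`, the distance `D n` must exceed any finite `M` from some index on.
Tightness bounds the probability of that event by any `ε`. -/
theorem ae_eq_zero_of_le_mul_of_tight {x : Ω → ℝ≥0∞} {l D : ℕ → Ω → ℝ≥0∞}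
    (hx : ∀ n, ∀ᵐ ω ∂P, x ω ≤ l n ω * D n ω)
    (hl : ∀ᵐ ω ∂P, Tendsto (fun n => l n ω) atTop (𝓝 0))
    (hD : ∀ ε : ℝ≥0∞, 0 < ε → ∃ M : ℝ≥0∞, M ≠ ∞ ∧ ∀ n, P {ω | M < D n ω} ≤ ε) :
    ∀ᵐ ω ∂P, x ω = 0 := by
  rw [ae_iff]
  refine le_antisymm (le_of_forall_pos_le_add fun ε hε => ?_) zero_le
  obtain ⟨M, hM, hMD⟩ := hD ε hε
  rw [zero_add]
  have hmono : Monotone fun N : ℕ => ⋂ n ≥ N, {ω | M < D n ω} := fun N N' h =>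
    Set.biInter_subset_biInter_left fun n hn => le_trans h hn
  calc P {ω | ¬ x ω = 0} ≤ P (⋃ N : ℕ, ⋂ n ≥ N, {ω | M < D n ω}) := by
        refine measure_mono_ae ?_
        filter_upwards [ae_all_iff.2 hx, hl] with ω h1 h2 h3
        have h3' : x ω ≠ 0 := h3
        have h4 : Tendsto (fun n => l n ω * M) atTop (𝓝 0) := by
          simpa using ENNReal.Tendsto.mul_const h2 (Or.inr hM)
        have h5 := h4.eventually_lt_const (pos_iff_ne_zero.2 h3')
        obtain ⟨N, hN⟩ := eventually_atTop.1 h5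
        refine Set.mem_iUnion.2 ⟨N, Set.mem_iInter₂.2 fun n hn => ?_⟩
        by_contra hlt
        have hlt' : D n ω ≤ M := not_lt.1 hlt
        exact ((h1 n).trans (mul_le_mul' le_rfl hlt')).not_gt (hN n hn)
    _ = ⨆ N : ℕ, P (⋂ n ≥ N, {ω | M < D n ω}) := hmono.measure_iUnion
    _ ≤ ε := iSup_le fun N =>
        (measure_mono (Set.biInter_subset_of_mem (le_refl N))).trans (hMD N)

variable [IsFiniteMeasure P] {E : Type*} [MetricSpace E] [MeasurableSpace E]
  [OpensMeasurableSpace E]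

theorem exists_tight_bound {v : ℤ → Ω → E} (hv : ∀ t, Measurable (v t))
    (hlaw : ∀ t, P.map (v t) = P.map (v 0)) (x₀ : E) {ε : ℝ≥0∞} (hε : 0 < ε) :
    ∃ M : ℕ, ∀ t, P {ω | (M : ℝ≥0∞) < edist (v t ω) x₀} ≤ ε := by
  have hs : ∀ M : ℕ, MeasurableSet {y : E | (M : ℝ≥0∞) < edist y x₀} := fun M =>
    measurableSet_lt measurable_const measurable_edist_left
  have hlim : Tendsto (fun M : ℕ => P.map (v 0) {y : E | (M : ℝ≥0∞) < edist y x₀}) atTop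
      (𝓝 (P.map (v 0) (⋂ M : ℕ, {y : E | (M : ℝ≥0∞) < edist y x₀}))) :=
    tendsto_measure_iInter_atTop (fun M => (hs M).nullMeasurableSet)
      (fun M N h y (hy : (N : ℝ≥0∞) < _) =>
        lt_of_le_of_lt (by exact_mod_cast h : (M : ℝ≥0∞) ≤ N) hy) ⟨0, measure_ne_top _ _⟩
  have hempty : (⋂ M : ℕ, {y : E | (M : ℝ≥0∞) < edist y x₀}) = ∅ := by
    refine Set.eq_empty_iff_forall_notMem.2 fun y hy => ?_
    obtain ⟨M, hM⟩ := ENNReal.exists_nat_gt (edist_ne_top y x₀)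
    exact (Set.mem_iInter.1 hy M).not_gt hM
  rw [hempty, measure_empty] at hlim
  obtain ⟨M, hM⟩ := (hlim.eventually_lt_const hε).exists
  refine ⟨M, fun t => ?_⟩
  rw [← hlaw t, Measure.map_apply (hv t) (hs M)] at hM
  exact hM.le

/-- Only the marginal laws of `u` and `v` matter; joint stationarity is not required. `x` is kept
abstract so that it may be a distance at the single point `θ₀`. -/
theorem ae_eq_zero_of_contraction {x : Ω → ℝ≥0∞} {l : ℕ → Ω → ℝ≥0∞} {u v : ℤ → Ω → E}
    (hu : ∀ t, Measurable (u t)) (hv : ∀ t, Measurable (v t))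
    (hu' : ∀ t, P.map (u t) = P.map (u 0)) (hv' : ∀ t, P.map (v t) = P.map (v 0)) (t : ℤ)
    (hx : ∀ n : ℕ, ∀ᵐ ω ∂P, x ω ≤ l n ω * edist (u (t - n) ω) (v (t - n) ω))
    (hl : ∀ᵐ ω ∂P, Tendsto (fun n => l n ω) atTop (𝓝 0)) :
    ∀ᵐ ω ∂P, x ω = 0 := by
  rcases isEmpty_or_nonempty E with hE | ⟨⟨x₀⟩⟩
  · exact Eventually.of_forall fun ω => hE.elim (u 0 ω)
  refine ae_eq_zero_of_le_mul_of_tight (D := fun n ω => edist (u (t - n) ω) (v (t - n) ω)) hx hl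
    fun ε hε => ?_
  obtain ⟨M, hM⟩ := exists_tight_bound hu hu' x₀ (ENNReal.half_pos hε.ne')
  obtain ⟨N, hN⟩ := exists_tight_bound hv hv' x₀ (ENNReal.half_pos hε.ne')
  refine ⟨M + N, by simp, fun n => ?_⟩
  calc P {ω | (M + N : ℝ≥0∞) < edist (u (t - n) ω) (v (t - n) ω)}
      ≤ P ({ω | (M : ℝ≥0∞) < edist (u (t - n) ω) x₀} ∪
          {ω | (N : ℝ≥0∞) < edist (v (t - n) ω) x₀}) := by
        refine measure_mono fun ω hω => ?_
        by_contra h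
        simp only [Set.mem_union, Set.mem_ofPred_eq, not_or, not_lt] at h hω
        exact hω.not_ge ((edist_triangle_right _ _ x₀).trans (add_le_add h.1 h.2))
    _ ≤ ε / 2 + ε / 2 := (measure_union_le _ _).trans (add_le_add (hM _) (hN _))
    _ = ε := ENNReal.add_halves ε

end Comparison

/-! ### Stationary sequences and their factors -/

section Stationary

variable {Ω : Type*} [MeasurableSpace Ω] {P : Measure Ω}
variable {F E : Type*} [MeasurableSpace F] [MeasurableSpace E]

theorem IsStationaryErgodic.isStationary {v : ℤ → Ω → E} (h : IsStationaryErgodic P v) :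
    IsStationary P v :=
  ⟨h.1, h.2.toMeasurePreserving⟩

theorem IsStationary.map_eq {v : ℤ → Ω → E} (h : IsStationary P v) (t : ℤ) :
    P.map (v t) = P.map (v 0) := by
  have hv : Measurable fun ω t => v t ω := measurable_pi_lambda _ h.1
  have h1 := (measurePreserving_shiftBy h.2 t).map_eq
  have h2 := congrArg (Measure.map fun w : ℤ → E => w 0) h1
  rw [Measure.map_map (measurable_shiftBy t) hv,
    Measure.map_map (measurable_pi_apply 0) ((measurable_shiftBy t).comp hv),
    Measure.map_map (measurable_pi_apply 0) hv] at h2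
  simpa [Function.comp_def, shiftBy] using h2

theorem IsStationaryErgodic.factor {v : ℤ → Ω → F} (h : IsStationaryErgodic P v)
    {G : (ℤ → F) → ℤ → E} (hG : Measurable G) (hcomm : ∀ w, G (shift w) = shift (G w)) :
    IsStationaryErgodic P fun t ω => G (fun k => v k ω) t := by
  have hv : Measurable fun ω t => v t ω := measurable_pi_lambda _ h.1
  refine ⟨fun t => (measurable_pi_apply t).comp (hG.comp hv), ?_⟩
  have : P.map (fun ω t => G (fun k => v k ω) t) = (P.map fun ω t => v t ω).map G :=
    (Measure.map_map hG hv).symm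
  rw [this]
  exact (hG.measurePreserving _).ergodic_of_ergodic_semiconj h.2 (measurable_shiftBy 1) hcomm

theorem IsStationaryErgodic.congr_ae {v v' : ℤ → Ω → E} (h : IsStationaryErgodic P v)
    (hv' : ∀ t, Measurable (v' t)) (hae : ∀ t, v' t =ᵐ[P] v t) : IsStationaryErgodic P v' := by
  refine ⟨hv', ?_⟩
  have : (fun ω t => v' t ω) =ᵐ[P] fun ω t => v t ω := by
    filter_upwards [ae_all_iff.2 hae] with ω hω
    exact funext hω
  rw [Measure.map_congr this]
  exact h.2

end Stationary

/-! ### Measurability and continuity of the volatility maps -/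

section VolMap

variable {d : ℕ} {K : Compacts (EuclideanSpace ℝ (Fin d))} {p q : ℕ}

/-- The Borel σ-field of `C(K, [0, ∞)^q)` is generated by the evaluations at the points of `K`. -/
theorem measurable_volFun_of_eval {W : Type*} {m : MeasurableSpace W} {f : W → VolFun K q}
    (hf : ∀ θ, Measurable fun w => f w θ) : Measurable f := by
  obtain ⟨S, hSc, hS⟩ := exists_countable_dense K
  have := hSc.to_subtype
  have hcont : Continuous fun (u : VolFun K q) (θ : S) => u θ :=
    continuous_pi fun θ => continuous_eval_const _
  have hinj : Function.Injective fun (u : VolFun K q) (θ : S) => u θ := by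
    intro u v huv
    refine DFunLike.coe_injective (u.continuous.ext_on hS v.continuous fun θ hθ => ?_)
    exact congrFun huv ⟨θ, hθ⟩
  -- Lusin–Souslin: a continuous injection of a Polish space into a countable product is a
  -- measurable embedding.
  rw [← (hcont.measurableEmbedding hinj).measurable_comp_iff]
  exact measurable_pi_lambda _ fun θ => hf θ

variable {g : K → (Fin p → ℝ) → Orthant q → ℝ≥0}
  {hg : ∀ x, Continuous fun y : K × Orthant q => g y.1 x y.2}

theorem continuous_volMap (x : Fin p → ℝ) : Continuous (volMap g hg x) := by
  refine ContinuousMap.continuous_of_continuous_uncurry _ ?_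
  have h1 : Continuous fun y : VolFun K q × K => y.1 y.2 := by fun_prop
  exact continuous_consShift ((hg x).comp (continuous_snd.prodMk h1)) h1

theorem measurable_volMap (hg_meas : ∀ θ s, Measurable fun x => g θ x s) (s : VolFun K q) :
    Measurable fun x => volMap g hg x s := by
  refine measurable_volFun_of_eval fun θ => ?_
  have : Continuous fun a : ℝ≥0 => consShift a (s θ) :=
    continuous_consShift continuous_id continuous_const
  exact this.measurable.comp (hg_meas θ (s θ))

/-- Iterating the volatility maps and evaluating at `θ` amounts to iterating the recursion with
volatility function `g_θ`. -/
theorem pastIterate_volMap_apply {x : ℤ → Fin p → ℝ} {θ : K} {s : ℤ → Orthant q}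
    (hs : ∀ t, s (t + 1) = consShift (g θ (x t) (s t)) (s t)) (t : ℤ) (n : ℕ) :
    ∀ {f : VolFun K q}, f θ = s (t - n) →
      pastIterate (fun k => volMap g hg (x k)) (t - 1) n f θ = s t := by
  induction n with
  | zero =>
    intro f hf
    simpa [pastIterate] using hf
  | succ n ih =>
    intro f hf
    refine ih (f := volMap g hg (x (t - 1 - n)) f) ?_
    have e : t - ((n + 1 : ℕ) : ℤ) = t - 1 - n := by push_cast; ring
    have h1 := hs (t - 1 - n)
    rw [← e, ← hf, e, show t - 1 - (n : ℤ) + 1 = t - n by ring] at h1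
    exact h1.symm

theorem enorm_toVec (f : VolFun K q) :
    ‖toVec f‖ₑ = edist f (ContinuousMap.const K (WithLp.toLp 2 fun _ => 0)) := by
  have h0 : toVec (ContinuousMap.const K (WithLp.toLp 2 fun _ : Fin q => (0 : ℝ≥0))) = 0 := by
    ext θ i
    simp [toVec]
  rw [edist_dist, dist_eq_norm_toVec, h0, sub_zero, ofReal_norm]

theorem hHat_eq_pastIterate {Ω : Type*} (X : ℤ → Ω → ℝ) (ς : Orthant q) (ω : Ω) (n : ℕ) :
    hHat g hg X ς n ω =
      pastIterate (fun t => Phi g hg X t ω) (n - 1) n (ContinuousMap.const K ς) := by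
  induction n with
  | zero => rfl
  | succ n ih =>
    have := pastIterate_succ_apply (fun t => Phi g hg X t ω) (n - 1) n (ContinuousMap.const K ς)
    rw [sub_add_cancel, ← ih] at this
    rw [Nat.cast_succ, add_sub_cancel_right, this]
    rfl

/-- The volatility map driven by the values `w_0, w_{-1}, …, w_{-p+1}` of a path. -/
def pathMap (g : K → (Fin p → ℝ) → Orthant q → ℝ≥0)
    (hg : ∀ x, Continuous fun y : K × Orthant q => g y.1 x y.2) (w : ℤ → ℝ) :
    VolFun K q → VolFun K q :=
  volMap g hg fun i => w (-(i : ℕ))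

theorem shiftedMaps_pathMap {Ω : Type*} (X : ℤ → Ω → ℝ) (ω : Ω) :
    shiftedMaps (pathMap g hg) (fun k => X k ω) = fun t => Phi g hg X t ω := by
  ext1 t
  rw [shiftedMaps, pathMap, Phi]
  congr 1
  ext i
  rw [shiftBy, obsVec, neg_add_eq_sub]

theorem pathMap_path {Ω : Type*} (X : ℤ → Ω → ℝ) (ω : Ω) :
    pathMap g hg (fun k => X k ω) = Phi g hg X 0 ω := by
  have := congrFun (shiftedMaps_pathMap (g := g) (hg := hg) X ω) 0
  rwa [shiftedMaps, shiftBy_zero] at this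

theorem measurable_pathMap (hg_meas : ∀ θ s, Measurable fun x => g θ x s) (s : VolFun K q) :
    Measurable fun w => pathMap g hg w s :=
  (measurable_volMap hg_meas s).comp (measurable_pi_lambda _ fun _ => measurable_pi_apply _)

end VolMap

/-! ### The model -/

section Model

variable {Ω : Type*}

theorem past_mono (Z : ℤ → Ω → ℝ) {s t : ℤ} (h : s ≤ t) : past Z s ≤ past Z t :=
  iSup_mono fun _ => iSup_mono' fun hk => ⟨hk.trans h, le_rfl⟩

theorem measurable_past (Z : ℤ → Ω → ℝ) {s t : ℤ} (h : s ≤ t) : Measurable[past Z t] (Z s) :=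
  (comap_measurable (Z s)).mono (le_iSup_of_le s (le_iSup_of_le h le_rfl)) le_rfl

theorem volVec_succ {p q : ℕ} {gθ : (Fin p → ℝ) → Orthant q → ℝ≥0} {X : ℤ → Ω → ℝ}
    {σ : ℤ → Ω → ℝ≥0} {ω : Ω} {t : ℤ}
    (h : σ (t + 1) ω ^ 2 = gθ (obsVec p X t ω) (volVec q σ t ω)) :
    volVec q σ (t + 1) ω =
      consShift (gθ (obsVec p X t ω) (volVec q σ t ω)) (volVec q σ t ω) := by
  ext i
  rw [← h]
  by_cases hi : (i : ℕ) = 0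
  · simp [volVec, consShift, hi]
  · have : t + 1 - (i : ℕ) = t - ((i : ℕ) - 1 : ℕ) := by omega
    simp [volVec, consShift, hi, this]

variable [MeasurableSpace Ω] {P : Measure Ω} {Z : ℤ → Ω → ℝ}

theorem past_le (hZ : ∀ t, Measurable (Z t)) (t : ℤ) : past Z t ≤ ‹MeasurableSpace Ω› :=
  iSup_le fun k => iSup_le fun _ => (hZ k).comap_le

variable {p q : ℕ} {gθ : (Fin p → ℝ) → Orthant q → ℝ≥0} {X : ℤ → Ω → ℝ} {σ : ℤ → Ω → ℝ≥0}

/-- `X` equals `σ Z` only almost surely and need not be adapted itself; the product is an exactly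
adapted version. -/
theorem IsModelSolution.measurable_mul (h : IsModelSolution P Z gθ X σ) {s t : ℤ} (hst : s ≤ t) :
    Measurable[past Z t] fun ω => (σ s ω : ℝ) * Z s ω :=
  ((h.adapted s).mono (past_mono Z (by omega)) le_rfl).coe_nnreal_real.mul (measurable_past Z hst)

theorem IsModelSolution.ae_volVec_succ (h : IsModelSolution P Z gθ X σ) :
    ∀ᵐ ω ∂P, ∀ t, volVec q σ (t + 1) ω =
      consShift (gθ (obsVec p X t ω) (volVec q σ t ω)) (volVec q σ t ω) := by
  filter_upwards [ae_all_iff.2 h.vol_eq] with ω hω t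
  refine volVec_succ ?_
  simpa using hω (t + 1)

theorem IsStationaryErgodic.volVec (h : IsStationaryErgodic P fun t ω => (X t ω, σ t ω)) (q : ℕ) :
    IsStationaryErgodic P (volVec q σ) := by
  refine h.factor (G := fun w t => WithLp.toLp 2 fun j : Fin q => (w (t - (j : ℕ))).2 ^ 2) ?_ ?_
  · refine measurable_pi_lambda _ fun t => (WithLp.measurable_toLp 2 _).comp ?_
    exact measurable_pi_lambda _ fun j => ((measurable_pi_apply _).snd).pow_const 2
  · intro w
    ext t j
    simp only [shift, sub_add_eq_add_sub]

theorem IsStationaryErgodic.obs (h : IsStationaryErgodic P fun t ω => (X t ω, σ t ω)) :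
    IsStationaryErgodic P X :=
  h.factor (G := fun w t => (w t).1)
    (measurable_pi_lambda _ fun _ => (measurable_pi_apply _).fst) fun _ => rfl

variable {d : ℕ} {K : Compacts (EuclideanSpace ℝ (Fin d))}
  {g : K → (Fin p → ℝ) → Orthant q → ℝ≥0}
  {hg : ∀ x, Continuous fun y : K × Orthant q => g y.1 x y.2}

theorem IsStationaryErgodic.Phi (h : IsStationaryErgodic P X)
    (hg_meas : ∀ θ s, Measurable fun x => g θ x s) :
    IsStationaryErgodic P (Phi g hg X) := by
  have := h.factor (G := shiftedMaps (pathMap g hg)) ?_ ?_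
  · simp_rw [shiftedMaps_pathMap] at this
    exact this
  · refine measurable_pi_lambda _ fun t => measurable_pi_lambda _ fun s => ?_
    exact (measurable_pathMap hg_meas s).comp (measurable_shiftBy t)
  · intro w
    ext1 t
    refine congrArg (pathMap g hg) ((shiftBy_shiftBy t 1 w).trans ?_)
    rfl

theorem tendsto_expE_neg_mul {κ : ℝ} (hκ : 0 < κ) :
    Tendsto (fun n : ℕ => expE (-κ * n)) atTop (𝓝 0) := by
  have h1 : Tendsto (fun n : ℕ => -κ * (n : ℝ)) atTop atBot :=
    tendsto_natCast_atTop_atTop.const_mul_atTop_of_neg (by linarith)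
  simpa [expE] using ENNReal.tendsto_ofReal (Real.tendsto_exp_atBot.comp h1)

theorem tendsto_exp_mul_of_edist_le {κ : ℝ} (hκ : 0 < κ) {C : ℝ≥0∞} (hC : C ≠ ∞) {y : ℕ → ℝ}
    (hy0 : ∀ n, 0 ≤ y n) (hy : ∀ᶠ n : ℕ in atTop, ENNReal.ofReal (y n) ≤ expE (-κ * n) * C) :
    Tendsto (fun n : ℕ => Real.exp (κ / 2) ^ n * y n) atTop (𝓝 0) := by
  have hlim : Tendsto (fun n : ℕ => Real.exp (-(κ / 2)) ^ n * C.toReal) atTop (𝓝 0) := by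
    simpa using (tendsto_pow_atTop_nhds_zero_of_lt_one (Real.exp_nonneg _)
      (Real.exp_lt_one_iff.2 (by linarith : -(κ / 2) < 0))).mul_const C.toReal
  refine squeeze_zero' (Eventually.of_forall fun n => mul_nonneg (by positivity) (hy0 n)) ?_ hlim
  filter_upwards [hy] with n hn
  have h1 : y n ≤ Real.exp (-κ * n) * C.toReal := by
    rw [← ENNReal.ofReal_toReal hC, expE, ← ENNReal.ofReal_mul (Real.exp_nonneg _)] at hn
    exact (ENNReal.ofReal_le_ofReal_iff (by positivity)).1 hn
  calc _ ≤ Real.exp (κ / 2) ^ n * (Real.exp (-κ * n) * C.toReal) := by gcongr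
    _ = _ := by
      rw [← mul_assoc, ← Real.exp_nat_mul, ← Real.exp_nat_mul, ← Real.exp_add]
      congr 2
      ring

end Model

end CondHet

open CondHet in
theorem proposition3p12
    {Ω : Type*} [MeasurableSpace Ω] (P : Measure Ω) [IsProbabilityMeasure P]
    (p q d : ℕ) (K : Compacts (EuclideanSpace ℝ (Fin d))) (θ₀ : K)
    (Z : ℤ → Ω → ℝ) (hZ : CondHet.IsInnovation P Z)
    (g : K → (Fin p → ℝ) → CondHet.Orthant q → ℝ≥0)
    (hg_meas : ∀ θ s, Measurable fun x => g θ x s)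
    (hg : ∀ x, Continuous fun y : K × CondHet.Orthant q => g y.1 x y.2)
    (X : ℤ → Ω → ℝ) (σ : ℤ → Ω → ℝ≥0)
    (hXσ : CondHet.IsUniqueStationaryErgodicSolution P Z (g θ₀) X σ) :
    -- `(Φ_t)` is stationary ergodic, with the σ-field generated by the evaluations on the maps
    CondHet.IsStationaryErgodic P (CondHet.Phi g hg X) ∧
    ∀ ς : CondHet.Orthant q,
      CondHet.FiniteLogPosMoment P
        (fun ω => ‖CondHet.toVec (CondHet.Phi g hg X 0 ω (ContinuousMap.const K ς))‖ₑ) →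
      CondHet.FiniteLogPosMoment P (fun ω => CondHet.lipCoeff (CondHet.Phi g hg X 0 ω)) →
      (∃ r : ℕ, 1 ≤ r ∧ CondHet.NegativeLogMean P (fun ω =>
        CondHet.lipCoeff (CondHet.pastIterate (fun t => CondHet.Phi g hg X t ω) 0 r))) →
      ∃ h : ℤ → Ω → CondHet.VolFun K q,
        CondHet.IsSRESolution P (CondHet.Phi g hg X) h ∧
        CondHet.IsStationaryErgodic P h ∧
        (∀ h' : ℤ → Ω → CondHet.VolFun K q,
          CondHet.IsSRESolution P (CondHet.Phi g hg X) h' → CondHet.IsStationary P h' →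
            ∀ t, ∀ᵐ ω ∂P, h' t ω = h t ω) ∧
        (∀ t, Measurable[CondHet.past Z (t - 1)] (h t)) ∧
        (∀ t, ∀ᵐ ω ∂P, h t ω θ₀ = CondHet.volVec q σ t ω) ∧
        CondHet.TendstoZeroEAS P (fun (t : ℕ) ω =>
          CondHet.toVec (CondHet.hHat g hg X ς t ω) - CondHet.toVec (h t ω)) := by
  have hsol := hXσ.solution
  have hX : IsStationaryErgodic P X := hXσ.stationary_ergodic.obs
  refine ⟨hX.Phi hg_meas, fun ς hmom hlip ⟨r, hr, hneg⟩ => ?_⟩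
  have hpath : Measurable fun ω t => X t ω := measurable_pi_lambda _ hX.1
  set μ : Measure (ℤ → ℝ) := P.map fun ω t => X t ω with hμ
  have : IsProbabilityMeasure μ := Measure.isProbabilityMeasure_map hpath.aemeasurable
  have hT : Ergodic shift μ := hX.2
  set ψ := pathMap g hg
  have hψc : ∀ w, Continuous (ψ w) := fun w => continuous_volMap _
  have hψm : ∀ s, Measurable fun w => ψ w s := measurable_pathMap hg_meas
  have hψt : ∀ t s, Measurable fun w => shiftedMaps ψ w t s := fun t s =>
    (hψm s).comp (measurable_shiftBy t)
  -- the logarithmic moments on the path space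
  have hm1 : Measurable fun w => lipCoeff (ψ w) := measurable_lipCoeff hψc hψm
  have hmr : Measurable fun w => lipCoeff (pastIterate (shiftedMaps ψ w) 0 r) :=
    measurable_lipCoeff (fun w => continuous_pastIterate (fun t => hψc _) 0 r) fun s =>
      measurable_pastIterate (φ := fun t w => shiftedMaps ψ w t) (fun t w => hψc _)
        (fun t _ => hψt t) r measurable_const
  have hm0 : Measurable fun w => edist (ψ w (ContinuousMap.const K ς))
      (ContinuousMap.const K (WithLp.toLp 2 fun _ => 0)) :=
    (hψm _).edist measurable_const
  have hlip' : FiniteLogPosMoment μ fun w => lipCoeff (ψ w) := by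
    rw [hμ, finiteLogPosMoment_map_iff hpath hm1]
    simpa only [ψ, pathMap_path] using hlip
  have hmom' : FiniteLogPosMoment μ fun w => edist (ψ w (ContinuousMap.const K ς))
      (ContinuousMap.const K (WithLp.toLp 2 fun _ => 0)) := by
    rw [hμ, finiteLogPosMoment_map_iff hpath hm0]
    simpa only [ψ, pathMap_path, ← enorm_toVec] using hmom
  have hneg' : NegativeLogMean μ fun w => lipCoeff (pastIterate (shiftedMaps ψ w) 0 r) := by
    rw [hμ, negativeLogMean_map_iff hpath hmr]
    simpa only [ψ, shiftedMaps_pathMap] using hneg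
  obtain ⟨κ, hκ, hfwd, hbwd⟩ := exists_exponential_contraction hT hr hm1 hmr hlip' hneg'
  have hconv := ae_exists_tendsto_backward hT hm0 hmom' hκ hbwd
  have hbwd_all : ∀ᵐ ω ∂P, ∀ t, ∀ᶠ n : ℕ in atTop,
      lipCoeff (pastIterate (fun k => Phi g hg X k ω) (t - 1) n) ≤ expE (-κ * n) := by
    filter_upwards [ae_of_ae_map hpath.aemeasurable (ae_shiftBy hT.toMeasurePreserving hbwd)]
      with ω hω t
    have := hω t
    simp_rw [← pastIterate_shiftedMaps, ψ, shiftedMaps_pathMap] at this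
    rwa [neg_add_eq_sub] at this
  have hlim_all : ∀ t, ∀ᵐ ω ∂P, Tendsto (fun n : ℕ =>
      lipCoeff (pastIterate (fun k => Phi g hg X k ω) (t - 1) n)) atTop (𝓝 0) := by
    intro t
    filter_upwards [hbwd_all] with ω hω
    exact tendsto_of_tendsto_of_tendsto_of_le_of_le' tendsto_const_nhds (tendsto_expE_neg_mul hκ)
      (Eventually.of_forall fun n => zero_le) (hω t)
  -- the version of the observations that is adapted to the innovations
  set X' : ℤ → Ω → ℝ := fun t ω => σ t ω * Z t ω with hX'
  have hX'past : ∀ {s t : ℤ}, s ≤ t → Measurable[past Z t] (X' s) := hsol.measurable_mul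
  have hX'm : ∀ t, Measurable (X' t) := fun t =>
    (hX'past le_rfl).mono (past_le hZ.measurable t) le_rfl
  have hX'X : ∀ t, X' t =ᵐ[P] X t := fun t => (hsol.obs_eq t).mono fun ω h => h.symm
  have hX'path : ∀ᵐ ω ∂P, (fun t => X' t ω) = fun t => X t ω := by
    filter_upwards [ae_all_iff.2 hX'X] with ω hω
    exact funext hω
  have hX'se : IsStationaryErgodic P X' := hX.congr_ae hX'm hX'X
  -- Evaluating the limit along `X'` instead of `X` changes `h` only on a null set and makes it
  -- exactly measurable with respect to the past.
  set h : ℤ → Ω → VolFun K q :=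
    fun t ω => backwardLimit ψ (ContinuousMap.const K ς) t fun k => X' k ω with hh
  have hsre : ∀ᵐ ω ∂P, ∀ t, h (t + 1) ω = Phi g hg X t ω (h t ω) := by
    filter_upwards [hX'path, ae_of_ae_map hpath.aemeasurable hconv] with ω h1 h2 t
    simp only [hh, h1]
    rw [backwardLimit_succ hψc h2]
    exact congrFun (congrFun (shiftedMaps_pathMap X ω) t) _
  have hse : IsStationaryErgodic P h := by
    refine hX'se.factor (G := fun w t => backwardLimit ψ (ContinuousMap.const K ς) t w) ?_ ?_
    · exact measurable_pi_lambda _ fun t =>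
        measurable_backwardLimit (π := id) hψc _ fun k _ => hψt k
    · intro w
      ext1 t
      exact backwardLimit_shift _ _ _ _
  refine ⟨h, ae_all_iff.1 hsre, hse, ?_, ?_, ?_, ?_⟩
  · intro h' hsre' hst' t
    have := ae_eq_zero_of_contraction (x := fun ω => edist (h' t ω) (h t ω)) hst'.1 hse.1
      hst'.map_eq hse.isStationary.map_eq t (fun n => ?_) (hlim_all t)
    · filter_upwards [this] with ω hω
      exact edist_eq_zero.1 hω
    · filter_upwards [hsre, ae_all_iff.2 hsre'] with ω h1 h2
      calc edist (h' t ω) (h t ω)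
          = edist (pastIterate (fun k => Phi g hg X k ω) (t - 1) n (h' (t - n) ω))
            (pastIterate (fun k => Phi g hg X k ω) (t - 1) n (h (t - n) ω)) := by
            rw [← eq_pastIterate (s := fun t => h' t ω) h2,
              ← eq_pastIterate (s := fun t => h t ω) h1]
        _ ≤ _ := edist_le_lipCoeff_mul _ _ _
  · intro t
    refine measurable_backwardLimit hψc _ fun k hk s => ?_
    simp only [ψ, shiftedMaps_pathMap]
    have hobs : Measurable[past Z (t - 1)] (obsVec p X' k) :=
      @measurable_pi_lambda _ _ _ (past Z (t - 1)) _ _ fun i => hX'past (by omega)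
    exact (measurable_volMap hg_meas s).comp hobs
  · intro t
    have hvol := hXσ.stationary_ergodic.volVec q
    -- These constant functions need not solve the recurrence, but they are stationary, and
    -- iterating from them reproduces the volatility vector at the coordinate `θ₀`. That is all the
    -- comparison uses.
    have hvol' : IsStationaryErgodic P fun t ω => ContinuousMap.const K (volVec q σ t ω) :=
      hvol.factor (G := fun w t => ContinuousMap.const K (w t))
        (measurable_pi_lambda _ fun t =>
          ContinuousMap.continuous_const'.measurable.comp (measurable_pi_apply t)) fun _ => rfl
    have := ae_eq_zero_of_contraction (x := fun ω => edist (h t ω θ₀) (volVec q σ t ω)) hse.1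
      hvol'.1 hse.isStationary.map_eq hvol'.isStationary.map_eq t (fun n => ?_) (hlim_all t)
    · filter_upwards [this] with ω hω
      exact edist_eq_zero.1 hω
    · filter_upwards [hsre, hsol.ae_volVec_succ] with ω h1 h2
      calc edist (h t ω θ₀) (volVec q σ t ω)
          = edist (pastIterate (fun k => Phi g hg X k ω) (t - 1) n (h (t - n) ω) θ₀)
            (pastIterate (fun k => Phi g hg X k ω) (t - 1) n
              (ContinuousMap.const K (volVec q σ (t - n) ω)) θ₀) := by
            rw [← eq_pastIterate (s := fun t => h t ω) h1]
            congr 1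
            exact (pastIterate_volMap_apply (s := fun t => volVec q σ t ω) h2 t n rfl).symm
        _ ≤ edist (pastIterate (fun k => Phi g hg X k ω) (t - 1) n (h (t - n) ω))
            (pastIterate (fun k => Phi g hg X k ω) (t - 1) n
              (ContinuousMap.const K (volVec q σ (t - n) ω))) := by
            rw [edist_dist, edist_dist]
            exact ENNReal.ofReal_le_ofReal (ContinuousMap.dist_apply_le_dist θ₀)
        _ ≤ _ := edist_le_lipCoeff_mul _ _ _
  · refine ⟨Real.exp (κ / 2), Real.one_lt_exp_iff.2 (by linarith), ?_⟩
    filter_upwards [hsre, ae_of_ae_map hpath.aemeasurable hfwd] with ω h1 h2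
    refine tendsto_exp_mul_of_edist_le hκ (edist_ne_top (ContinuousMap.const K ς) (h 0 ω))
      (fun n => norm_nonneg _) ?_
    filter_upwards [h2] with n hn
    simp only [ψ, shiftedMaps_pathMap] at hn
    -- Both sequences are the same forward composition, applied to `ς` and to `h 0`; half of the
    -- rate `κ` then suffices for the claimed `γ`.
    rw [← dist_eq_norm_toVec, ← edist_dist, hHat_eq_pastIterate,
      eq_pastIterate (s := fun t => h t ω) h1 n n, sub_self]
    exact (edist_le_lipCoeff_mul _ _ _).trans (mul_le_mul' hn le_rfl)
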